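/- **Setting.** Let $S=(M_1,M_2,\Delta,T)$ with $M_1,M_2$ positive even integers, $M=M_1M_2$, $\Delta>0$, $T\in\mathbb N$. Put $u_{i,j}=\Delta(i,j)^\top$ ($1\le i\le M_1$, $1\le j\le M_2$) and $\omega_{m_1,m_2}=\frac{2\pi}{\Delta}(m_1/M_1,m_2/M_2)^\top$. Let $I_C=\{(0,0),(\frac{M_1}2,0),(0,\frac{M_2}2),(\frac{M_1}2,\frac{M_2}2)\}$, and let $I$ consist of the indices $(m_1,0),(m_1,\frac{M_2}2)$ with $1\le m_1\le\frac{M_1}2-1$, the indices $(0,m_2),(\frac{M_1}2,m_2)$ with $1\le m_2\le\frac{M_2}2-1$, and the indices $(m_1,m_2)$ with $1\le m_1\le\frac{M_1}2-1$ and $1\le |m_2|\le\frac{M_2}2-1$. Let $H_1$ be the $M\times M$ matrix with rows indexed by the grid points $u_{i,j}$ and columns $\cos(\omega_m^\top u_{i,j})$ for $m\in I_C$, then $2\cos(\omega_m^\top u_{i,j})$ for $m\in I$, then $-2\sin(\omega_m^\top u_{i,j})$ for $m\in I$. Let $L_1=H_1(H_1^\top H_1)^{-1/2}$. For covariates $f_1,\dots,f_p:\mathbb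 R^2\to\mathbb R$ with $p\ge 1$, let $\tilde X$ be the $M\times p$ matrix of their values at the grid points and $X_1=L_1^\top\tilde X$. For a family $f_\vartheta:\mathbb R^2\to\mathbb R$, $\vartheta>0$, let $$\tilde f^\Delta_\vartheta(\omega)=\sum_{l\in\mathbb Z^2,\ \max(|l_1|,|l_2|)\le T}f_\vartheta\Big(\omega+\frac{2\pi}{\Delta}l\Big),$$ let $\tilde\Lambda_\vartheta$ be the $M\times M$ diagonal matrix with entries $(2\pi/\Delta)^2\tilde f^\Delta_\vartheta(\omega_m)$, with $m$ running over $I_C$, $I$ and $I$ as above, and let $\tilde Q_\vartheta=\tilde\Lambda_\vartheta^{-1}-\tilde\Lambda_\vartheta^{-1}X_1(X_1^\top\tilde\Lambda_\vartheta^{-1}X_1)^{-1}X_1^\top\tilde\Lambda_\vartheta^{-1}$. The (unnormalized) approximate marginal reference prior is $$\pi^{AR}(\vartheta)=\Big\{\mathrm{tr}\big[\{(\partial_\vartheta\tilde\Lambda_\vartheta)\tilde Q_\vartheta\}^2\big]-\frac1{M-p}\big[\mathrm{tr}\{(\partial_\vartheta\tilde\Lambda_\vartheta)\tilde Q_\vartheta\}\big]^2\Big\}^{1/2}.$$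 **Assumption (A1).** For all $\vartheta>0$, $\int_{\mathbb R^2} f_\vartheta=1$ and $f_\vartheta(\omega)=h_1(\omega)h_2(\vartheta)/(\|\omega\|^2+u(\vartheta))^a$, where $h_1\ge0$ is continuous on $\mathbb R^2$, $a$ is a real constant, $h_2,u$ are positive and continuously differentiable on $(0,\infty)$, and $\lim_{\vartheta\to0^+}f_\vartheta(\omega)=0$ for every $\omega$. **Assumption (A2)** on $n\times n$ correlation matrices $\Sigma_\vartheta$. There are $J\in\mathbb N$, continuous functions $q_0,\dots,q_J$ on $(0,\infty)$, fixed symmetric matrices $D^{(0)},\dots,D^{(J)}$ with $\bigcap_i\mathrm{Ker}\,D^{(i)}=\{0\}$, and a matrix-valued function $R$ (on whose size nothing is assumed), such that $\Sigma_\vartheta=\sum_{i=0}^Jq_i(\vartheta)D^{(i)}+R(\vartheta)$ for all large $\vartheta$. **Theorem.** Assume $f_1\equiv1$ (the mean function $\sum_j\beta_jf_j$ has an intercept), $p<M$, $X_1$ has rank $p$, $f_\vartheta$ satisfies (A1), and $\tilde f^\Delta_\vartheta(\omega_m)>0$ for all $\vartheta>0$ and $m\in I_C\cup I$ (so that $\tilde\Lambda_\vartheta$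 is non-singular). (a) $\pi^{AR}$ is continuous on $(0,\infty)$ and $$\pi^{AR}(\vartheta)=O\Big(|u'(\vartheta)|\wedge\frac{|u'(\vartheta)|}{u(\vartheta)^2}\Big)\quad\text{as }\vartheta\to0^+\text{ and as }\vartheta\to\infty .$$ So if $|u'|\wedge|u'|u^{-2}$ is integrable on $(0,\infty)$, then $\pi^{AR}$ is proper, i.e. integrable on $(0,\infty)$. (b) Suppose $|u'|\wedge|u'|u^{-2}$ is integrable on $(0,\infty)$. Let $K_\vartheta$ be the isotropic correlation function with spectral density $f_\vartheta$, i.e. $K_\vartheta(\|h\|)=\int_{\mathbb R^2} e^{\mathrm i\omega^\top h}f_\vartheta(\omega)\,d\omega$ for all $h\in\mathbb R^2$. Let $s_1,\dots,s_n\in\mathbb R^2$ be distinct with $n>p$, let the $n\times p$ design matrix $X=(f_j(s_i))$ have rank $p$, and let $\Sigma_\vartheta=(K_\vartheta(\|s_i-s_j\|))_{i,j}$ satisfy (A2). Let $L(\beta,\sigma^2,\vartheta;z)$ be the density at $z$ of $\mathrm N(X\beta,\sigma^2\Sigma_\vartheta)$. Then for Lebesgue-almost every $z\in\mathbb R^n$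 the approximate reference posterior, proportional to $L(\beta,\sigma^2,\vartheta;z)\,\pi^{AR}(\vartheta)/\sigma^2$, is proper: this function is integrable over $(\beta,\sigma^2,\vartheta)\in\mathbb R^p\times(0,\infty)\times(0,\infty)$. -/

import Mathlib

open Filter Topology MeasureTheory Set
open scoped Matrix

noncomputable section

/-- The plane, with its Euclidean norm, carrying both locations and angular frequencies. -/
abbrev Plane : Type := EuclideanSpace ℝ (Fin 2)

/-- Tuning constants of the spectral approximation: two positive even integers, a grid
spacing `Δ > 0`, and the truncation level `T` of the aliasing series. -/
structure SpectralDesign where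
  M₁ : ℕ
  M₂ : ℕ
  M₁_pos : 0 < M₁
  M₂_pos : 0 < M₂
  M₁_even : Even M₁
  M₂_even : Even M₂
  Δ : ℝ
  Δ_pos : 0 < Δ
  T : ℕ

namespace SpectralDesign

variable (S : SpectralDesign)

/-- `M = M₁ M₂`. -/
def M : ℕ := S.M₁ * S.M₂

/-- Labels of the grid points `u_{i,j}`. -/
abbrev GridIdx : Type := Fin S.M₁ × Fin S.M₂

/-- Grid point `u_{i,j} = Δ (i, j)` with `1 ≤ i ≤ M₁`, `1 ≤ j ≤ M₂`
(the labels in `Fin` start at `0`). -/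
def gridPoint (k : S.GridIdx) : Plane :=
  !₂[S.Δ * ((k.1 : ℝ) + 1), S.Δ * ((k.2 : ℝ) + 1)]

/-- Frequency `ω_{m₁,m₂} = (2π/Δ) (m₁/M₁, m₂/M₂)`. -/
def freq (m : ℤ × ℤ) : Plane :=
  !₂[2 * Real.pi / (S.Δ * S.M₁) * m.1, 2 * Real.pi / (S.Δ * S.M₂) * m.2]

/-- Corner indices. -/
def cornerIdx : Finset (ℤ × ℤ) :=
  {(0, 0), ((S.M₁ : ℤ) / 2, 0), (0, (S.M₂ : ℤ) / 2), ((S.M₁ : ℤ) / 2, (S.M₂ : ℤ) / 2)}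

/-- Boundary indices. -/
def boundaryIdx : Finset (ℤ × ℤ) :=
  (Finset.Icc 1 ((S.M₁ : ℤ) / 2 - 1) ×ˢ {0, (S.M₂ : ℤ) / 2}) ∪
    ({0, (S.M₁ : ℤ) / 2} ×ˢ Finset.Icc 1 ((S.M₂ : ℤ) / 2 - 1))

/-- Interior indices. -/
def interiorIdx : Finset (ℤ × ℤ) :=
  Finset.Icc 1 ((S.M₁ : ℤ) / 2 - 1) ×ˢ Finset.Icc 1 ((S.M₂ : ℤ) / 2 - 1)

/-- Exterior indices. -/
def exteriorIdx : Finset (ℤ × ℤ) :=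
  Finset.Icc 1 ((S.M₁ : ℤ) / 2 - 1) ×ˢ Finset.Icc (-((S.M₂ : ℤ) / 2) + 1) (-1)

/-- Union of the boundary, interior and exterior indices. -/
def innerIdx : Finset (ℤ × ℤ) := S.boundaryIdx ∪ S.interiorIdx ∪ S.exteriorIdx

/-- Labels of the `M` coefficients: corner cosines, then inner cosines, then inner sines. -/
abbrev CoefIdx : Type := S.cornerIdx ⊕ (S.innerIdx ⊕ S.innerIdx)

/-- The frequency index belonging to a coefficient. -/
def coefFreqIdx : S.CoefIdx → ℤ × ℤ
  | .inl m => m.1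
  | .inr (.inl m) => m.1
  | .inr (.inr m) => m.1

/-- The `M × M` matrix `H₁`; its column for the corner index `(0, 0)` is the vector of ones. -/
def H₁ : Matrix S.GridIdx S.CoefIdx ℝ :=
  Matrix.of fun k c => match c with
    | .inl m => Real.cos (inner ℝ (S.freq m.1) (S.gridPoint k))
    | .inr (.inl m) => 2 * Real.cos (inner ℝ (S.freq m.1) (S.gridPoint k))
    | .inr (.inr m) => -2 * Real.sin (inner ℝ (S.freq m.1) (S.gridPoint k))

/-- `L₁ = H₁ (H₁ᵀ H₁)^{-1/2}`, the inverse square root being taken by functional calculus of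
symmetric matrices. -/
def L₁ : Matrix S.GridIdx S.CoefIdx ℝ :=
  S.H₁ * cfc (fun x : ℝ => (Real.sqrt x)⁻¹) (S.H₁ᵀ * S.H₁)

/-- `X̃`: the covariates `F` at the grid points. -/
def gridDesignMatrix {p : ℕ} (F : Fin p → Plane → ℝ) : Matrix S.GridIdx (Fin p) ℝ :=
  Matrix.of fun k j => F j (S.gridPoint k)

/-- `X₁ = L₁ᵀ X̃`. -/
def X₁ {p : ℕ} (F : Fin p → Plane → ℝ) : Matrix S.CoefIdx (Fin p) ℝ :=
  S.L₁ᵀ * S.gridDesignMatrix F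

/-- The truncated aliased spectral density: the sum of `f_ϑ (ω + (2π/Δ) l)` over integer
vectors `l` with `max |l₁| |l₂| ≤ T`. -/
def aliasDensity (f : ℝ → Plane → ℝ) (ϑ : ℝ) (ω : Plane) : ℝ :=
  ∑ l ∈ Finset.Icc (-(S.T : ℤ)) S.T ×ˢ Finset.Icc (-(S.T : ℤ)) S.T,
    f ϑ (ω + (2 * Real.pi / S.Δ) • !₂[(l.1 : ℝ), (l.2 : ℝ)])

/-- The diagonal matrix `Λ̃_ϑ`, where `c_Δ = (2π/Δ)²`. -/
def Lam (f : ℝ → Plane → ℝ) (ϑ : ℝ) : Matrix S.CoefIdx S.CoefIdx ℝ :=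
  Matrix.diagonal fun c =>
    (2 * Real.pi / S.Δ) ^ 2 * S.aliasDensity f ϑ (S.freq (S.coefFreqIdx c))

/-- Entrywise derivative of `Λ̃_ϑ` in `ϑ`. -/
def derivLam (f : ℝ → Plane → ℝ) (ϑ : ℝ) : Matrix S.CoefIdx S.CoefIdx ℝ :=
  Matrix.of fun c c' => deriv (fun t => S.Lam f t c c') ϑ

/-- `Q̃_ϑ = Λ̃⁻¹ - Λ̃⁻¹ X₁ (X₁ᵀ Λ̃⁻¹ X₁)⁻¹ X₁ᵀ Λ̃⁻¹`. -/
def Q {p : ℕ} (f : ℝ → Plane → ℝ) (F : Fin p → Plane → ℝ) (ϑ : ℝ) :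
    Matrix S.CoefIdx S.CoefIdx ℝ :=
  (S.Lam f ϑ)⁻¹ -
    (S.Lam f ϑ)⁻¹ * S.X₁ F * ((S.X₁ F)ᵀ * (S.Lam f ϑ)⁻¹ * S.X₁ F)⁻¹ * (S.X₁ F)ᵀ * (S.Lam f ϑ)⁻¹

/-- The (unnormalized) approximate marginal reference prior `π^AR(ϑ)`. -/
def approxRefPrior {p : ℕ} (f : ℝ → Plane → ℝ) (F : Fin p → Plane → ℝ) (ϑ : ℝ) : ℝ :=
  Real.sqrt
    (((S.derivLam f ϑ * S.Q f F ϑ) ^ 2).trace -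
      1 / ((S.M : ℝ) - p) * (S.derivLam f ϑ * S.Q f F ϑ).trace ^ 2)

end SpectralDesign

/-- Assumption (A1) on the family `f_ϑ`, `ϑ > 0`, of normalized spectral densities. -/
structure AssumptionA1 (f : ℝ → Plane → ℝ) (h₁ : Plane → ℝ) (h₂ u : ℝ → ℝ) (a : ℝ) : Prop where
  integral_eq_one : ∀ ϑ, 0 < ϑ → ∫ ω, f ϑ ω = 1
  form : ∀ ϑ, 0 < ϑ → ∀ ω, f ϑ ω = h₁ ω * h₂ ϑ / (‖ω‖ ^ 2 + u ϑ) ^ a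
  h₁_nonneg : ∀ ω, 0 ≤ h₁ ω
  h₁_continuous : Continuous h₁
  h₂_pos : ∀ ϑ, 0 < ϑ → 0 < h₂ ϑ
  h₂_contDiff : ContDiffOn ℝ 1 h₂ (Ioi 0)
  u_pos : ∀ ϑ, 0 < ϑ → 0 < u ϑ
  u_contDiff : ContDiffOn ℝ 1 u (Ioi 0)
  tendsto_zero : ∀ ω, Tendsto (fun ϑ => f ϑ ω) (𝓝[>] 0) (𝓝 0)

/-- `K_ϑ` is the isotropic correlation function in the plane with spectral density `f_ϑ`. -/
def IsCorrelationWithDensity (K : ℝ → ℝ → ℝ) (f : ℝ → Plane → ℝ) : Prop :=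
  ∀ ϑ, 0 < ϑ → ∀ h : Plane,
    ((K ϑ ‖h‖ : ℝ) : ℂ) =
      ∫ ω : Plane, Complex.exp (Complex.I * ((inner ℝ ω h : ℝ) : ℂ)) * ((f ϑ ω : ℝ) : ℂ)

/-- The correlation matrix `Σ_ϑ` of the data at the locations `s`. -/
def corrMatrix {n : ℕ} (K : ℝ → ℝ → ℝ) (s : Fin n → Plane) (ϑ : ℝ) : Matrix (Fin n) (Fin n) ℝ :=
  Matrix.of fun i j => K ϑ ‖s i - s j‖

/-- Assumption (A2) on a family of `n × n` correlation matrices. No size restriction is put on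
the remainder `R`. -/
def AssumptionA2 {n : ℕ} (Sig : ℝ → Matrix (Fin n) (Fin n) ℝ) : Prop :=
  ∃ (J : ℕ) (q : Fin (J + 1) → ℝ → ℝ) (D : Fin (J + 1) → Matrix (Fin n) (Fin n) ℝ)
    (R : ℝ → Matrix (Fin n) (Fin n) ℝ),
    (∀ i, ContinuousOn (q i) (Ioi 0)) ∧
    (∀ i, (D i).IsSymm) ∧
    (∀ x : Fin n → ℝ, (∀ i, D i *ᵥ x = 0) → x = 0) ∧
    ∀ᶠ ϑ in atTop, Sig ϑ = ∑ i, q i ϑ • D i + R ϑ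

/-- The `n × p` design matrix `X` of the covariates `F` at the locations `s`. -/
def designMatrix {n p : ℕ} (F : Fin p → Plane → ℝ) (s : Fin n → Plane) :
    Matrix (Fin n) (Fin p) ℝ :=
  Matrix.of fun i j => F j (s i)

/-- The Gaussian likelihood `L(β, σ², ϑ; z)`: the density at `z` of `N(X β, σ² Σ_ϑ)`;
the argument `v` is `σ²`. -/
def gaussianLikelihood {n p : ℕ} (K : ℝ → ℝ → ℝ) (s : Fin n → Plane) (F : Fin p → Plane → ℝ)
    (z : Fin n → ℝ) (β : Fin p → ℝ) (v ϑ : ℝ) : ℝ :=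
  (2 * Real.pi * v) ^ (-(n : ℝ) / 2) * (corrMatrix K s ϑ).det ^ (-(1 : ℝ) / 2) *
    Real.exp
      (-((z - designMatrix F s *ᵥ β) ⬝ᵥ
          ((corrMatrix K s ϑ)⁻¹ *ᵥ (z - designMatrix F s *ᵥ β))) / (2 * v))

end

/-! Part (a). Write `∂Λ = Λ B`, with `B` the diagonal matrix of logarithmic derivatives of the
entries of `Λ`. Since `Q Λ Q = Q`, the matrix `E = Λ Q` is idempotent with trace `M - p`, and the
squared prior is `tr (B E B E) - (tr (B E))² / tr E`. This contrast ignores multiples of the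
identity in `B`, so it is at most `β² (M - p)` once the entries of `B` lie within `β` of a common
`α` (`trace_sq_sub_sq_trace_le`). Each entry of `B` is an average, over aliased frequencies `x`, of
`h₂'/h₂ - a u' / (‖x‖² + u)`. The choice `α = h₂'/h₂` leaves a deviation `O(|u'|)` provided `x`
stays away from `0`; the choice `α = h₂'/h₂ - a u'/u` leaves `O(|u'| / u²)` because `‖x‖` is
bounded. Only the origin coefficient has an aliased frequency equal to `0`. The intercept removes
it: the rotated constant covariate is a multiple of the origin basis vector, and `Q X₁ = 0`, so the
origin row and column of `Q` vanish. The bound holds for every `ϑ > 0` with one constant.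

Part (b). The posterior mass is averaged over the data instead of being bounded for each `z`. Let `P
X = 1` and `N = 1 - X P`, and weight `z` by the indicator of `r < ‖N z‖ < R`, `‖P z‖ < R`. By
Tonelli, translating `z` by `X β` makes the `β`-integral the volume of a ball. What remains is the
`dv / v`-integral of the probability that a centred normal vector with covariance `v Σ` is carried
by `N` into the annulus. By scale invariance of `dv / v` this is bounded independently of `Σ`, hence
of `ϑ`, and integrating against the proper prior gives a finite average. So the posterior mass is
finite for almost every weighted `z`, and countably many such weights cover `N z ≠ 0`, which is
almost everything as `p < n`. Positive definiteness of `Σ` comes from its spectral representation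
and the independence of characters. -/

noncomputable section

/-! ### Generalized least squares residuals and the trace contrast. -/

section WeightedResidual

variable {ι κ : Type*} [Fintype ι] [DecidableEq ι] [Fintype κ] [DecidableEq κ]

/-- The generalized least squares residual matrix of the design `Y` with covariance `D`. -/
def glsResidual (D : Matrix ι ι ℝ) (Y : Matrix ι κ ℝ) : Matrix ι ι ℝ :=
  D⁻¹ - D⁻¹ * Y * (Yᵀ * D⁻¹ * Y)⁻¹ * Yᵀ * D⁻¹

theorem Matrix.mulVec_injective_of_rank_eq {ι κ : Type*} [Fintype κ] {Y : Matrix ι κ ℝ} (h : Y.rank = Fintype.card κ) :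
    Function.Injective Y.mulVec := by
  have h1 := LinearMap.finrank_range_add_finrank_ker Y.mulVecLin
  rw [← Matrix.rank, h, Module.finrank_fintype_fun_eq_card] at h1
  have h2 : Module.finrank ℝ (LinearMap.ker Y.mulVecLin) = 0 := by omega
  rw [Submodule.finrank_eq_zero] at h2
  exact LinearMap.ker_eq_bot.1 h2

theorem isUnit_det_gram {ι κ : Type*} [Fintype ι] [Fintype κ] [DecidableEq κ]
    {W : Matrix ι ι ℝ} (hW : W.PosDef) {Y : Matrix ι κ ℝ}
    (h : Y.rank = Fintype.card κ) : IsUnit (Yᵀ * W * Y).det := by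
  have := hW.conjTranspose_mul_mul_same (B := Y) (Matrix.mulVec_injective_of_rank_eq h)
  rw [Matrix.conjTranspose_eq_transpose_of_trivial] at this
  exact this.det_pos.ne'.isUnit

variable {D : Matrix ι ι ℝ} {Y : Matrix ι κ ℝ}

theorem glsResidual_transpose (hD : Dᵀ = D) : (glsResidual D Y)ᵀ = glsResidual D Y := by
  have h1 : (D⁻¹)ᵀ = D⁻¹ := by rw [Matrix.transpose_nonsing_inv, hD]
  simp only [glsResidual, Matrix.transpose_sub, Matrix.transpose_mul, Matrix.transpose_transpose,
    h1, Matrix.transpose_nonsing_inv, Matrix.mul_assoc]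

theorem glsResidual_mul_design (hY : IsUnit (Yᵀ * D⁻¹ * Y).det) : glsResidual D Y * Y = 0 := by
  have h : (Yᵀ * D⁻¹ * Y)⁻¹ * (Yᵀ * D⁻¹ * Y) = 1 := Matrix.nonsing_inv_mul _ hY
  have : D⁻¹ * Y * (Yᵀ * D⁻¹ * Y)⁻¹ * Yᵀ * D⁻¹ * Y
      = D⁻¹ * Y * ((Yᵀ * D⁻¹ * Y)⁻¹ * (Yᵀ * D⁻¹ * Y)) := by
    simp only [Matrix.mul_assoc]
  rw [glsResidual, Matrix.sub_mul, this, h, Matrix.mul_one, sub_self]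

theorem mul_glsResidual (hD : IsUnit D.det) :
    D * glsResidual D Y = 1 - Y * ((Yᵀ * D⁻¹ * Y)⁻¹ * Yᵀ * D⁻¹) := by
  rw [glsResidual, Matrix.mul_sub, Matrix.mul_nonsing_inv _ hD]
  simp only [Matrix.mul_assoc, Matrix.mul_nonsing_inv_cancel_left _ _ hD]

/-- `D * glsResidual D Y` is the identity minus a matrix with range in that of `Y`, which the
residual annihilates. This is the idempotence behind the trace contrast. -/
theorem glsResidual_mul_mul_self (hD : IsUnit D.det) (hY : IsUnit (Yᵀ * D⁻¹ * Y).det) :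
    glsResidual D Y * D * glsResidual D Y = glsResidual D Y := by
  rw [Matrix.mul_assoc, mul_glsResidual hD, Matrix.mul_sub, ← Matrix.mul_assoc,
    glsResidual_mul_design hY, Matrix.zero_mul, Matrix.mul_one, sub_zero]

theorem trace_mul_glsResidual (hD : IsUnit D.det) (hY : IsUnit (Yᵀ * D⁻¹ * Y).det) :
    (D * glsResidual D Y).trace = Fintype.card ι - Fintype.card κ := by
  rw [mul_glsResidual hD, Matrix.trace_sub, Matrix.trace_mul_comm]
  have : (Yᵀ * D⁻¹ * Y)⁻¹ * Yᵀ * D⁻¹ * Y = (Yᵀ * D⁻¹ * Y)⁻¹ * (Yᵀ * D⁻¹ * Y) := by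
    simp only [Matrix.mul_assoc]
  rw [this, Matrix.nonsing_inv_mul _ hY, Matrix.trace_one, Matrix.trace_one]

/-- The contrast `tr (B E B E) - (tr (B E))² / tr E` of the diagonal matrix `B` with entries
`b`, where `E = Λ Q` is idempotent, is unchanged by `b ↦ b - α`; hence the bound. -/
theorem trace_sq_sub_sq_trace_le {Q : Matrix ι ι ℝ} {lam b : ι → ℝ} {α β : ℝ}
    (hlam : ∀ c, 0 < lam c) (hQ : Qᵀ = Q) (hQQ : Q * Matrix.diagonal lam * Q = Q)
    (hpos : 0 < (Matrix.diagonal lam * Q).trace)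
    (hb : ∀ c, (∀ c', Q c c' = 0) ∨ |b c - α| ≤ β) :
    ((Matrix.diagonal (fun c => lam c * b c) * Q) ^ 2).trace
      - 1 / (Matrix.diagonal lam * Q).trace *
        (Matrix.diagonal (fun c => lam c * b c) * Q).trace ^ 2
      ≤ β ^ 2 * (Matrix.diagonal lam * Q).trace := by
  have hsym : ∀ c c', Q c' c = Q c c' := fun c c' => congrFun (congrFun hQ c) c'
  -- The weights are nonnegative, and `Q Λ Q = Q` gives them equal row and column sums `e`. The
  -- trace of the square is then a weighted sum of products `b c * b c'`.
  set w : ι → ι → ℝ := fun c c' => lam c * lam c' * Q c c' ^ 2 with hw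
  set e : ι → ℝ := fun c => lam c * Q c c with he
  have hwe : ∀ c, ∑ c', w c c' = e c := by
    intro c
    have := congrFun (congrFun hQQ c) c
    rw [Matrix.mul_apply] at this
    simp only [Matrix.mul_diagonal] at this
    simp only [hw, he]
    rw [← this, Finset.mul_sum]
    refine Finset.sum_congr rfl fun c' _ => ?_
    rw [hsym c c']; ring
  have hwe' : ∀ c', ∑ c, w c c' = e c' := by
    intro c'
    rw [← hwe c']
    refine Finset.sum_congr rfl fun c _ => ?_
    simp only [hw]; rw [hsym c c']; ring
  set k := (Matrix.diagonal lam * Q).trace with hk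
  have hke : ∑ c, e c = k := by
    simp [hk, Matrix.trace, Matrix.diagonal_mul, he]
  have htr : (Matrix.diagonal (fun c => lam c * b c) * Q).trace = ∑ c, e c * b c := by
    simp only [Matrix.trace, Matrix.diag_apply, Matrix.diagonal_mul, he]
    exact Finset.sum_congr rfl fun c _ => by ring
  have htr2 : ((Matrix.diagonal (fun c => lam c * b c) * Q) ^ 2).trace
      = ∑ c, ∑ c', w c c' * (b c * b c') := by
    rw [pow_two]
    simp only [Matrix.trace, Matrix.diag_apply, Matrix.mul_apply (M := Matrix.diagonal _ * Q),
      Matrix.diagonal_mul, hw]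
    refine Finset.sum_congr rfl fun c _ => Finset.sum_congr rfl fun c' _ => ?_
    rw [hsym c c']; ring
  set d : ι → ℝ := fun c => b c - α with hd
  have hshift : ∑ c, ∑ c', w c c' * (b c * b c')
      = ∑ c, ∑ c', w c c' * (d c * d c') + 2 * α * ∑ c, e c * b c - α ^ 2 * k := by
    have h1 : ∀ c c', w c c' * (b c * b c')
        = w c c' * (d c * d c') + α * (w c c' * b c) + α * (w c c' * b c') - α ^ 2 * w c c' := by
      intro c c'; simp only [hd]; ring
    have h2 : ∑ c, ∑ c', w c c' * b c = ∑ c, e c * b c := by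
      refine Finset.sum_congr rfl fun c _ => ?_
      rw [← Finset.sum_mul, hwe]
    have h3 : ∑ c, ∑ c', w c c' * b c' = ∑ c, e c * b c := by
      rw [Finset.sum_comm]
      refine Finset.sum_congr rfl fun c _ => ?_
      rw [← Finset.sum_mul, hwe']
    simp only [h1, Finset.sum_sub_distrib, Finset.sum_add_distrib, ← Finset.mul_sum, h2, h3, hwe,
      hke]
    ring
  have hbound : ∑ c, ∑ c', w c c' * (d c * d c') ≤ β ^ 2 * k := by
    rw [← hke, Finset.mul_sum]
    refine Finset.sum_le_sum fun c _ => ?_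
    rw [← hwe, Finset.mul_sum]
    refine Finset.sum_le_sum fun c' _ => ?_
    have hw0 : 0 ≤ w c c' :=
      mul_nonneg (mul_nonneg (hlam c).le (hlam c').le) (sq_nonneg _)
    -- Indices without control on `b` have a zero row of `Q`, hence zero weight.
    rcases hb c with h | h
    · simp [hw, h c']
    rcases hb c' with h' | h'
    · simp [hw, ← hsym c c', h' c]
    have : d c * d c' ≤ β ^ 2 := by
      calc d c * d c' ≤ |d c * d c'| := le_abs_self _
        _ = |d c| * |d c'| := abs_mul _ _
        _ ≤ β * β := mul_le_mul h h' (abs_nonneg _) ((abs_nonneg _).trans h)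
        _ = β ^ 2 := by ring
    nlinarith [mul_le_mul_of_nonneg_left this hw0]
  rw [htr, htr2, hshift]
  set t := ∑ c, e c * b c
  -- The terms created by the shift complete a square with a negative sign, so they can be dropped.
  have : 2 * α * t - α ^ 2 * k - 1 / k * t ^ 2 = - ((t - α * k) ^ 2 / k) := by
    field_simp; ring
  have h5 : 0 ≤ (t - α * k) ^ 2 / k := by positivity
  linarith

end WeightedResidual

/-! ### Functional calculus on eigenvectors. -/

section Spectral

open Polynomial in
/-- The continuous functional calculus acts on an eigenvector through the eigenvalue. -/
theorem Matrix.IsHermitian.cfc_mulVec_of_eigenvector {ι : Type*} [Fintype ι] [DecidableEq ι]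
    {A : Matrix ι ι ℝ} (hA : A.IsHermitian) (g : ℝ → ℝ) {v : ι → ℝ} {μ : ℝ}
    (hv : A *ᵥ v = μ • v) : cfc g A *ᵥ v = g μ • v := by
  have hfin : (spectrum ℝ A).Finite := Matrix.finite_real_spectrum
  -- Adding `μ` to the interpolation nodes avoids showing that `μ` is in the spectrum, which may
  -- fail when `v = 0`.
  obtain ⟨P, hP⟩ : ∃ P : ℝ[X], ∀ x ∈ insert μ (spectrum ℝ A), P.eval x = g x := by
    refine ⟨Lagrange.interpolate (insert μ hfin.toFinset) id g, fun x hx => ?_⟩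
    exact Lagrange.eval_interpolate_at_node (v := id) g (Set.injOn_id _) (by simpa using hx)
  have h1 : cfc g A = Polynomial.aeval A P := by
    rw [← cfc_polynomial P A hA.isSelfAdjoint]
    exact cfc_congr fun x hx => (hP x (Set.mem_insert_of_mem _ hx)).symm
  have h2 : ∀ R : ℝ[X], Polynomial.aeval A R *ᵥ v = R.eval μ • v := by
    intro R
    induction R using Polynomial.induction_on' with
    | add p q hp hq => simp [Matrix.add_mulVec, hp, hq, add_smul]
    | monomial n r =>
      have hn : ∀ n : ℕ, (A ^ n) *ᵥ v = μ ^ n • v := by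
        intro n
        induction n with
        | zero => simp
        | succ n ih =>
          rw [pow_succ, ← Matrix.mulVec_mulVec, hv, Matrix.mulVec_smul, ih, smul_smul, pow_succ,
            mul_comm]
      rw [Polynomial.aeval_monomial, Polynomial.eval_monomial, ← Matrix.mulVec_mulVec, hn,
        Matrix.mulVec_smul, Matrix.algebraMap_eq_diagonal]
      ext i
      simp [Matrix.mulVec_diagonal, Pi.algebraMap_apply]
      ring
  rw [h1, h2, hP μ (Set.mem_insert _ _)]

end Spectral

/-! ### Vanishing sums of roots of unity. -/

section RootsOfUnity

theorem sum_exp_int_mul_eq_zero {N : ℕ} {m : ℤ} (h : ¬ (N : ℤ) ∣ m) :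
    ∑ i : Fin N, Complex.exp (2 * Real.pi * Complex.I * (m * ((i : ℂ) + 1) / N)) = 0 := by
  rcases Nat.eq_zero_or_pos N with rfl | hN
  · simp
  have hN' : (N : ℂ) ≠ 0 := by exact_mod_cast hN.ne'
  set z := Complex.exp (2 * Real.pi * Complex.I * (m / N)) with hz
  have hz1 : z ≠ 1 := by
    intro h1
    rw [hz, Complex.exp_eq_one_iff] at h1
    obtain ⟨k, hk⟩ := h1
    apply h
    refine ⟨k, ?_⟩
    have h2 : (2 * Real.pi * Complex.I : ℂ) ≠ 0 := Complex.two_pi_I_ne_zero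
    rw [mul_comm, mul_left_inj' h2, div_eq_iff hN'] at hk
    have : (m : ℂ) = ((N * k : ℤ) : ℂ) := by rw [hk]; push_cast; ring
    exact_mod_cast this
  have hzN : z ^ N = 1 := by
    rw [hz, ← Complex.exp_nat_mul, Complex.exp_eq_one_iff]
    exact ⟨m, by field_simp⟩
  have hterm : ∀ i : Fin N,
      Complex.exp (2 * Real.pi * Complex.I * (m * ((i : ℂ) + 1) / N)) = z * z ^ (i : ℕ) := by
    intro i
    rw [hz, ← Complex.exp_nat_mul, ← Complex.exp_add]
    congr 1
    field_simp
    ring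
  rw [Finset.sum_congr rfl fun i _ => hterm i, ← Finset.mul_sum,
    Fin.sum_univ_eq_sum_range (fun i => z ^ i), geom_sum_eq hz1, hzN]
  simp

end RootsOfUnity

/-! ### The discrete Fourier basis and the origin coefficient. -/

namespace SpectralDesign

variable (S : SpectralDesign)

theorem inner_freq_gridPoint (m : ℤ × ℤ) (k : S.GridIdx) :
    inner ℝ (S.freq m) (S.gridPoint k)
      = 2 * Real.pi * (m.1 * ((k.1 : ℝ) + 1) / S.M₁) +
        2 * Real.pi * (m.2 * ((k.2 : ℝ) + 1) / S.M₂) := by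
  have h1 : (S.M₁ : ℝ) ≠ 0 := by exact_mod_cast S.M₁_pos.ne'
  have h2 : (S.M₂ : ℝ) ≠ 0 := by exact_mod_cast S.M₂_pos.ne'
  have h3 := S.Δ_pos.ne'
  simp only [PiLp.inner_apply, Fin.sum_univ_two, freq, gridPoint]
  simp
  field_simp

theorem sum_exp_inner_eq_zero {m : ℤ × ℤ} (hm : ¬ (S.M₁ : ℤ) ∣ m.1 ∨ ¬ (S.M₂ : ℤ) ∣ m.2) :
    ∑ k : S.GridIdx,
      Complex.exp ((inner ℝ (S.freq m) (S.gridPoint k) : ℝ) * Complex.I) = 0 := by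
  have hterm : ∀ k : S.GridIdx,
      Complex.exp ((inner ℝ (S.freq m) (S.gridPoint k) : ℝ) * Complex.I)
        = Complex.exp (2 * Real.pi * Complex.I * (m.1 * ((k.1 : ℂ) + 1) / S.M₁)) *
          Complex.exp (2 * Real.pi * Complex.I * (m.2 * ((k.2 : ℂ) + 1) / S.M₂)) := by
    intro k
    rw [inner_freq_gridPoint, ← Complex.exp_add]
    congr 1
    push_cast
    ring
  rw [Finset.sum_congr rfl fun k _ => hterm k, Fintype.sum_prod_type]
  simp only [← Finset.mul_sum, ← Finset.sum_mul]
  rcases hm with h | h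
  · rw [sum_exp_int_mul_eq_zero h, zero_mul]
  · rw [sum_exp_int_mul_eq_zero h, mul_zero]

theorem sum_cos_inner_eq_zero {m : ℤ × ℤ} (hm : ¬ (S.M₁ : ℤ) ∣ m.1 ∨ ¬ (S.M₂ : ℤ) ∣ m.2) :
    ∑ k : S.GridIdx, Real.cos (inner ℝ (S.freq m) (S.gridPoint k)) = 0 := by
  have := congrArg Complex.re (S.sum_exp_inner_eq_zero hm)
  simpa only [Complex.re_sum, Complex.exp_ofReal_mul_I_re, Complex.zero_re] using this

theorem sum_sin_inner_eq_zero {m : ℤ × ℤ} (hm : ¬ (S.M₁ : ℤ) ∣ m.1 ∨ ¬ (S.M₂ : ℤ) ∣ m.2) :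
    ∑ k : S.GridIdx, Real.sin (inner ℝ (S.freq m) (S.gridPoint k)) = 0 := by
  have := congrArg Complex.im (S.sum_exp_inner_eq_zero hm)
  simpa only [Complex.im_sum, Complex.exp_ofReal_mul_I_im, Complex.zero_im] using this

/-- The coefficient of the constant function. -/
def originIdx : S.CoefIdx := .inl ⟨(0, 0), by simp [cornerIdx]⟩

theorem not_dvd_of_mem_innerIdx {m : ℤ × ℤ} (hm : m ∈ S.innerIdx) :
    ¬ (S.M₁ : ℤ) ∣ m.1 ∨ ¬ (S.M₂ : ℤ) ∣ m.2 := by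
  have h1 := S.M₁_pos
  have h2 := S.M₂_pos
  have key : ∀ (N : ℕ) (x : ℤ), 0 < N → 1 ≤ |x| → |x| ≤ (N : ℤ) / 2 - 1 → ¬ (N : ℤ) ∣ x := by
    intro N x hN hx hx' hd
    have := Int.le_of_dvd (by omega) ((dvd_abs _ _).2 hd)
    omega
  simp only [innerIdx, boundaryIdx, interiorIdx, exteriorIdx, Finset.mem_union,
    Finset.mem_product, Finset.mem_Icc, Finset.mem_insert, Finset.mem_singleton] at hm
  rcases hm with ((⟨h, -⟩ | ⟨-, h⟩) | ⟨h, -⟩) | ⟨h, -⟩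
  · exact Or.inl (key _ _ h1 (by rw [abs_of_pos] <;> omega) (by rw [abs_of_pos] <;> omega))
  · exact Or.inr (key _ _ h2 (by rw [abs_of_pos] <;> omega) (by rw [abs_of_pos] <;> omega))
  · exact Or.inl (key _ _ h1 (by rw [abs_of_pos] <;> omega) (by rw [abs_of_pos] <;> omega))
  · exact Or.inl (key _ _ h1 (by rw [abs_of_pos] <;> omega) (by rw [abs_of_pos] <;> omega))

theorem not_dvd_half {N : ℕ} (hN : 0 < N) (he : Even N) : ¬ (N : ℤ) ∣ (N : ℤ) / 2 := by
  obtain ⟨r, rfl⟩ := he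
  intro h
  have := Int.le_of_dvd (by omega) h
  omega

/-- This arithmetic fact is used twice: it makes the other columns of `H₁` orthogonal to constants,
and it keeps their aliased frequencies away from zero. -/
theorem not_dvd_of_ne_originIdx {c : S.CoefIdx} (hc : c ≠ S.originIdx) :
    ¬ (S.M₁ : ℤ) ∣ (S.coefFreqIdx c).1 ∨ ¬ (S.M₂ : ℤ) ∣ (S.coefFreqIdx c).2 := by
  rcases c with ⟨m, hm⟩ | ⟨m, hm⟩ | ⟨m, hm⟩
  · have h0 : m ≠ (0, 0) := by
      rintro rfl; exact hc rfl
    simp only [coefFreqIdx]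
    have h1 := not_dvd_half S.M₁_pos S.M₁_even
    have h2 := not_dvd_half S.M₂_pos S.M₂_even
    simp only [cornerIdx, Finset.mem_insert, Finset.mem_singleton] at hm
    rcases hm with rfl | rfl | rfl | rfl
    · exact absurd rfl h0
    · exact Or.inl h1
    · exact Or.inr h2
    · exact Or.inl h1
  · exact S.not_dvd_of_mem_innerIdx hm
  · exact S.not_dvd_of_mem_innerIdx hm

theorem H₁_originIdx (k : S.GridIdx) : S.H₁ k S.originIdx = 1 := by
  simp [H₁, originIdx, freq, PiLp.inner_apply]

theorem H₁_transpose_mulVec_one :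
    S.H₁ᵀ *ᵥ (fun _ => 1) = (S.M : ℝ) • Pi.single S.originIdx (1 : ℝ) := by
  ext c
  rw [Matrix.mulVec, dotProduct]
  simp only [Matrix.transpose_apply, mul_one, Pi.smul_apply, smul_eq_mul]
  by_cases hc : c = S.originIdx
  · subst hc
    simp [H₁_originIdx, M]
  rw [Pi.single_eq_of_ne hc, mul_zero]
  have h := S.not_dvd_of_ne_originIdx hc
  rcases c with m | m | m
  · simpa [H₁, coefFreqIdx] using S.sum_cos_inner_eq_zero h
  · simpa [H₁, coefFreqIdx, ← Finset.mul_sum] using S.sum_cos_inner_eq_zero h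
  · simpa [H₁, coefFreqIdx, ← Finset.mul_sum] using S.sum_sin_inner_eq_zero h

/-- The origin basis vector is mapped by `H₁` to the constant vector, and `H₁ᵀ` maps it back to `M`
times itself. It is thus an eigenvector of the Gram matrix for `M`, and the inverse square root acts
on it as `1 / √M`; no other Gram entry is needed. -/
theorem L₁_transpose_mulVec_one :
    S.L₁ᵀ *ᵥ (fun _ => 1) = Real.sqrt S.M • Pi.single S.originIdx (1 : ℝ) := by
  have hA : (S.H₁ᵀ * S.H₁).IsHermitian := by
    simpa using Matrix.isHermitian_conjTranspose_mul_self S.H₁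
  have hH : S.H₁ *ᵥ Pi.single S.originIdx 1 = fun _ => 1 := by
    ext k; simp [H₁_originIdx]
  have hev : (S.H₁ᵀ * S.H₁) *ᵥ Pi.single S.originIdx 1
      = (S.M : ℝ) • Pi.single S.originIdx (1 : ℝ) := by
    rw [← Matrix.mulVec_mulVec, hH, H₁_transpose_mulVec_one]
  have hcfc : (cfc (fun x : ℝ => (Real.sqrt x)⁻¹) (S.H₁ᵀ * S.H₁))ᵀ
      = cfc (fun x : ℝ => (Real.sqrt x)⁻¹) (S.H₁ᵀ * S.H₁) := by
    have : IsSelfAdjoint (cfc (fun x : ℝ => (Real.sqrt x)⁻¹) (S.H₁ᵀ * S.H₁)) :=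
      cfc_predicate _ _
    rw [← Matrix.conjTranspose_eq_transpose_of_trivial]
    exact this.star_eq
  rw [L₁, Matrix.transpose_mul, hcfc, ← Matrix.mulVec_mulVec, H₁_transpose_mulVec_one,
    Matrix.mulVec_smul, hA.cfc_mulVec_of_eigenvector _ hev, smul_smul]
  congr 1
  rw [← div_eq_mul_inv, Real.div_sqrt]

/-- An intercept among the covariates makes a residual of the rotated design vanish at the
origin coefficient. -/
theorem apply_originIdx_eq_zero {p : ℕ} {F : Fin p → Plane → ℝ} {j : Fin p}
    (hF : ∀ x, F j x = 1) {Q : Matrix S.CoefIdx S.CoefIdx ℝ} (hQ : Q * S.X₁ F = 0)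
    (c : S.CoefIdx) : Q c S.originIdx = 0 := by
  have hX : S.X₁ F *ᵥ Pi.single j 1 = Real.sqrt S.M • Pi.single S.originIdx (1 : ℝ) := by
    rw [X₁, ← Matrix.mulVec_mulVec, ← L₁_transpose_mulVec_one]
    congr 1
    ext k
    simp [gridDesignMatrix, hF]
  have h : ((Q * S.X₁ F) *ᵥ Pi.single j 1) c = ((0 : Matrix S.CoefIdx (Fin p) ℝ) *ᵥ
    Pi.single j 1) c := by rw [hQ]
  rw [← Matrix.mulVec_mulVec, hX, Matrix.mulVec_smul, Matrix.mulVec_single_one,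
    Matrix.zero_mulVec] at h
  change Real.sqrt S.M * Q c S.originIdx = 0 at h
  have hM : 0 < S.M := Nat.mul_pos S.M₁_pos S.M₂_pos
  have : Real.sqrt S.M ≠ 0 := (Real.sqrt_pos.2 (by exact_mod_cast hM)).ne'
  exact (mul_eq_zero.1 h).resolve_left this

/-- This count identifies `tr (Λ Q)` with the normalization `M - p` in the prior. -/
theorem card_coefIdx : Fintype.card S.CoefIdx = S.M := by
  obtain ⟨a, ha⟩ := S.M₁_even
  obtain ⟨b, hb⟩ := S.M₂_even
  have h1 := S.M₁_pos
  have h2 := S.M₂_pos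
  have ha' : (S.M₁ : ℤ) / 2 = a := by omega
  have hb' : (S.M₂ : ℤ) / 2 = b := by omega
  have ha0 : (0 : ℤ) < a := by omega
  have hb0 : (0 : ℤ) < b := by omega
  have hcor : S.cornerIdx.card = 4 := by
    simp only [cornerIdx, ha', hb']
    rw [Finset.card_insert_of_notMem, Finset.card_insert_of_notMem,
      Finset.card_insert_of_notMem, Finset.card_singleton] <;>
    simp [Prod.ext_iff] <;> omega
  have hpair : ∀ n : ℤ, 0 < n → ({0, n} : Finset ℤ).card = 2 := fun n hn =>
    Finset.card_pair hn.ne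
  have hbd : S.boundaryIdx.card = 2 * (a - 1) + 2 * (b - 1) := by
    rw [boundaryIdx, Finset.card_union_of_disjoint, Finset.card_product, Finset.card_product,
      ha', hb', hpair _ ha0, hpair _ hb0, Int.card_Icc, Int.card_Icc]
    · omega
    · rw [Finset.disjoint_left]
      rintro ⟨x, y⟩ h h'
      simp only [Finset.mem_product, Finset.mem_Icc, Finset.mem_insert,
        Finset.mem_singleton] at h h'
      omega
  have hin : S.interiorIdx.card = (a - 1) * (b - 1) := by
    rw [interiorIdx, Finset.card_product, ha', hb', Int.card_Icc, Int.card_Icc]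
    congr 1 <;> omega
  have hex : S.exteriorIdx.card = (a - 1) * (b - 1) := by
    rw [exteriorIdx, Finset.card_product, ha', hb', Int.card_Icc, Int.card_Icc]
    congr 1 <;> omega
  have hI : S.innerIdx.card
      = 2 * (a - 1) + 2 * (b - 1) + (a - 1) * (b - 1) + (a - 1) * (b - 1) := by
    rw [innerIdx, Finset.card_union_of_disjoint, Finset.card_union_of_disjoint, hbd, hin, hex]
    all_goals
      rw [Finset.disjoint_left]
      rintro ⟨x, y⟩ h h'
      simp only [boundaryIdx, interiorIdx, exteriorIdx, Finset.mem_union, Finset.mem_product,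
        Finset.mem_Icc, Finset.mem_insert, Finset.mem_singleton] at h h'
      omega
  simp only [Fintype.card_sum, Fintype.card_coe, hcor, hI, M, ha, hb]
  -- Substituting successors removes the truncated subtractions, leaving a polynomial identity.
  obtain ⟨a', rfl⟩ : ∃ a', a = a' + 1 := ⟨a - 1, by omega⟩
  obtain ⟨b', rfl⟩ : ∃ b', b = b' + 1 := ⟨b - 1, by omega⟩
  simp only [Nat.add_sub_cancel]
  ring

/-- Away from the origin coefficient, no aliased frequency vanishes. -/
theorem freq_add_ne_zero {m : ℤ × ℤ} (hm : ¬ (S.M₁ : ℤ) ∣ m.1 ∨ ¬ (S.M₂ : ℤ) ∣ m.2)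
    (l : ℤ × ℤ) :
    S.freq m + (2 * Real.pi / S.Δ) • (!₂[(l.1 : ℝ), (l.2 : ℝ)] : Plane) ≠ 0 := by
  intro h
  have h1 : (S.M₁ : ℝ) ≠ 0 := by exact_mod_cast S.M₁_pos.ne'
  have h2 : (S.M₂ : ℝ) ≠ 0 := by exact_mod_cast S.M₂_pos.ne'
  have h3 := S.Δ_pos.ne'
  have hpi := Real.pi_ne_zero
  have e1 := congrArg (fun x : Plane => x 0) h
  have e2 := congrArg (fun x : Plane => x 1) h
  simp [freq] at e1 e2
  have key : ∀ (N : ℕ) (x y : ℤ), (N : ℝ) ≠ 0 →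
      2 * Real.pi / (S.Δ * N) * x + 2 * Real.pi / S.Δ * y = 0 → (N : ℤ) ∣ x := by
    intro N x y hN hxy
    have : (x : ℝ) = N * (-y) := by
      field_simp at hxy
      rw [mul_zero] at hxy
      have := (mul_eq_zero.1 hxy).resolve_left (by positivity)
      linarith
    exact ⟨-y, by exact_mod_cast this⟩
  exact hm.elim (fun h => h (key _ _ _ h1 e1)) (fun h => h (key _ _ _ h2 e2))

end SpectralDesign

/-! ### Logarithmic derivatives of the spectral density. -/

namespace AssumptionA1

variable {f : ℝ → Plane → ℝ} {h₁ : Plane → ℝ} {h₂ u : ℝ → ℝ} {a : ℝ}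
  (hA : AssumptionA1 f h₁ h₂ u a)

include hA

theorem hasDerivAt_u {ϑ : ℝ} (hϑ : 0 < ϑ) : HasDerivAt u (deriv u ϑ) ϑ :=
  ((hA.u_contDiff.differentiableOn one_ne_zero).differentiableAt (Ioi_mem_nhds hϑ)).hasDerivAt

theorem hasDerivAt_h₂ {ϑ : ℝ} (hϑ : 0 < ϑ) : HasDerivAt h₂ (deriv h₂ ϑ) ϑ :=
  ((hA.h₂_contDiff.differentiableOn one_ne_zero).differentiableAt (Ioi_mem_nhds hϑ)).hasDerivAt

theorem continuousOn_deriv_u : ContinuousOn (deriv u) (Ioi 0) :=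
  hA.u_contDiff.continuousOn_deriv_of_isOpen isOpen_Ioi le_rfl

theorem continuousOn_deriv_h₂ : ContinuousOn (deriv h₂) (Ioi 0) :=
  hA.h₂_contDiff.continuousOn_deriv_of_isOpen isOpen_Ioi le_rfl

theorem denom_pos {ϑ : ℝ} (hϑ : 0 < ϑ) (x : Plane) : 0 < ‖x‖ ^ 2 + u ϑ := by
  have := hA.u_pos ϑ hϑ
  positivity

theorem density_nonneg {ϑ : ℝ} (hϑ : 0 < ϑ) (x : Plane) : 0 ≤ f ϑ x := by
  rw [hA.form ϑ hϑ]
  exact div_nonneg (mul_nonneg (hA.h₁_nonneg x) (hA.h₂_pos ϑ hϑ).le)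
    (Real.rpow_nonneg (hA.denom_pos hϑ x).le _)

/-- The logarithmic derivative in `ϑ` of a spectral density of the form (A1). -/
theorem hasDerivAt_density {ϑ : ℝ} (hϑ : 0 < ϑ) (x : Plane) :
    HasDerivAt (fun t => f t x)
      (f ϑ x * (deriv h₂ ϑ / h₂ ϑ - a * deriv u ϑ / (‖x‖ ^ 2 + u ϑ))) ϑ := by
  have hd := hA.denom_pos hϑ x
  have h2 := hA.h₂_pos ϑ hϑ
  have hpow : HasDerivAt (fun t => (‖x‖ ^ 2 + u t) ^ a)
      (deriv u ϑ * a * (‖x‖ ^ 2 + u ϑ) ^ (a - 1)) ϑ :=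
    ((hA.hasDerivAt_u hϑ).const_add _).rpow_const (Or.inl hd.ne')
  have hne : (‖x‖ ^ 2 + u ϑ) ^ a ≠ 0 := (Real.rpow_pos_of_pos hd a).ne'
  have h := ((hA.hasDerivAt_h₂ hϑ).const_mul (h₁ x)).div hpow hne
  have hev : (fun t => f t x) =ᶠ[𝓝 ϑ] fun t => h₁ x * h₂ t / (‖x‖ ^ 2 + u t) ^ a := by
    filter_upwards [Ioi_mem_nhds hϑ] with t ht using hA.form t ht x
  refine (h.congr_of_eventuallyEq hev).congr_deriv ?_
  rw [hA.form ϑ hϑ, Real.rpow_sub_one hd.ne']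
  field_simp

theorem continuousOn_density (x : Plane) : ContinuousOn (fun t => f t x) (Ioi 0) :=
  fun _ ht => (hA.hasDerivAt_density ht x).continuousAt.continuousWithinAt

variable (S : SpectralDesign)

theorem hasDerivAt_aliasDensity {ϑ : ℝ} (hϑ : 0 < ϑ) (ω : Plane) :
    HasDerivAt (fun t => S.aliasDensity f t ω)
      (∑ l ∈ Finset.Icc (-(S.T : ℤ)) S.T ×ˢ Finset.Icc (-(S.T : ℤ)) S.T,
        f ϑ (ω + (2 * Real.pi / S.Δ) • !₂[(l.1 : ℝ), (l.2 : ℝ)]) *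
          (deriv h₂ ϑ / h₂ ϑ - a * deriv u ϑ /
            (‖ω + (2 * Real.pi / S.Δ) • (!₂[(l.1 : ℝ), (l.2 : ℝ)] : Plane)‖ ^ 2 + u ϑ))) ϑ :=
  HasDerivAt.fun_sum fun _ _ => hA.hasDerivAt_density hϑ _

theorem continuousOn_aliasDensity (ω : Plane) :
    ContinuousOn (fun t => S.aliasDensity f t ω) (Ioi 0) :=
  fun _ ht => (hA.hasDerivAt_aliasDensity S ht ω).continuousAt.continuousWithinAt

theorem continuousOn_deriv_aliasDensity (ω : Plane) :
    ContinuousOn (deriv fun t => S.aliasDensity f t ω) (Ioi 0) := by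
  refine ContinuousOn.congr ?_ fun t ht => (hA.hasDerivAt_aliasDensity S ht ω).deriv
  refine continuousOn_finsetSum _ fun l _ => (hA.continuousOn_density _).mul ?_
  refine (hA.continuousOn_deriv_h₂.div hA.h₂_contDiff.continuousOn
    fun t ht => (hA.h₂_pos t ht).ne').sub ?_
  exact (continuousOn_const.mul hA.continuousOn_deriv_u).div
    (continuousOn_const.add hA.u_contDiff.continuousOn) fun t ht => (hA.denom_pos ht _).ne'

/-- The logarithmic derivative of a sum of nonnegative terms is their weighted average of
logarithmic derivatives, so a bound valid for each term passes to the sum. -/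
theorem abs_deriv_aliasDensity_sub_le {ϑ : ℝ} (hϑ : 0 < ϑ) (ω : Plane) {α β : ℝ}
    (hb : ∀ l ∈ Finset.Icc (-(S.T : ℤ)) S.T ×ˢ Finset.Icc (-(S.T : ℤ)) S.T,
      |deriv h₂ ϑ / h₂ ϑ - a * deriv u ϑ /
        (‖ω + (2 * Real.pi / S.Δ) • (!₂[(l.1 : ℝ), (l.2 : ℝ)] : Plane)‖ ^ 2 + u ϑ) - α| ≤ β) :
    |deriv (fun t => S.aliasDensity f t ω) ϑ - α * S.aliasDensity f ϑ ω|
      ≤ β * S.aliasDensity f ϑ ω := by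
  rw [(hA.hasDerivAt_aliasDensity S hϑ ω).deriv, SpectralDesign.aliasDensity, Finset.mul_sum,
    Finset.mul_sum, ← Finset.sum_sub_distrib]
  refine (Finset.abs_sum_le_sum_abs _ _).trans (Finset.sum_le_sum fun l hl => ?_)
  rw [mul_comm α, ← mul_sub, abs_mul, abs_of_nonneg (hA.density_nonneg hϑ _), mul_comm β]
  exact mul_le_mul_of_nonneg_left (hb l hl) (hA.density_nonneg hϑ _)

end AssumptionA1

/-! ### Continuity and bounds of the reference prior. -/

namespace SpectralDesign

variable (S : SpectralDesign) (f : ℝ → Plane → ℝ)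

/-- The diagonal entries of `Λ̃_ϑ`. -/
def lamEntry (ϑ : ℝ) (c : S.CoefIdx) : ℝ :=
  (2 * Real.pi / S.Δ) ^ 2 * S.aliasDensity f ϑ (S.freq (S.coefFreqIdx c))

theorem Lam_eq (ϑ : ℝ) : S.Lam f ϑ = Matrix.diagonal (S.lamEntry f ϑ) := rfl

theorem Q_eq {p : ℕ} (F : Fin p → Plane → ℝ) (ϑ : ℝ) :
    S.Q f F ϑ = glsResidual (Matrix.diagonal (S.lamEntry f ϑ)) (S.X₁ F) := rfl

theorem derivLam_eq (ϑ : ℝ) :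
    S.derivLam f ϑ = Matrix.diagonal fun c => deriv (fun t => S.lamEntry f t c) ϑ := by
  ext c c'
  rw [derivLam, Matrix.of_apply]
  by_cases h : c = c'
  · subst h; simp [Lam_eq]
  · simp [Lam_eq, h]

theorem approxRefPrior_nonneg {p : ℕ} (F : Fin p → Plane → ℝ) (ϑ : ℝ) :
    0 ≤ S.approxRefPrior f F ϑ := Real.sqrt_nonneg _

/-- The squared norms of the aliased frequencies are bounded. -/
theorem exists_norm_alias_le : ∃ R : ℝ, 0 < R ∧ ∀ c : S.CoefIdx,
    ∀ l ∈ Finset.Icc (-(S.T : ℤ)) S.T ×ˢ Finset.Icc (-(S.T : ℤ)) S.T,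
      ‖S.freq (S.coefFreqIdx c) +
        (2 * Real.pi / S.Δ) • (!₂[(l.1 : ℝ), (l.2 : ℝ)] : Plane)‖ ^ 2 ≤ R := by
  set g : S.CoefIdx × (ℤ × ℤ) → ℝ := fun q => ‖S.freq (S.coefFreqIdx q.1) +
        (2 * Real.pi / S.Δ) • (!₂[(q.2.1 : ℝ), (q.2.2 : ℝ)] : Plane)‖ ^ 2 with hg
  set A := (Finset.univ : Finset S.CoefIdx) ×ˢ
    (Finset.Icc (-(S.T : ℤ)) S.T ×ˢ Finset.Icc (-(S.T : ℤ)) S.T)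
  have h0 : ∀ q ∈ A, 0 ≤ g q := fun q _ => by positivity
  -- The added `1` only secures strict positivity.
  refine ⟨∑ q ∈ A, g q + 1, by have := Finset.sum_nonneg h0; positivity, fun c l hl => ?_⟩
  have := Finset.single_le_sum h0 (a := (c, l)) (Finset.mem_product.2 ⟨Finset.mem_univ _, hl⟩)
  exact this.trans (by linarith)

/-- The squared norms of the aliased frequencies are bounded below, the origin excepted. -/
theorem exists_le_norm_alias : ∃ r : ℝ, 0 < r ∧ ∀ c : S.CoefIdx, c ≠ S.originIdx →
    ∀ l ∈ Finset.Icc (-(S.T : ℤ)) S.T ×ˢ Finset.Icc (-(S.T : ℤ)) S.T,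
      r ≤ ‖S.freq (S.coefFreqIdx c) +
        (2 * Real.pi / S.Δ) • (!₂[(l.1 : ℝ), (l.2 : ℝ)] : Plane)‖ ^ 2 := by
  set g : S.CoefIdx × (ℤ × ℤ) → ℝ := fun q => ‖S.freq (S.coefFreqIdx q.1) +
        (2 * Real.pi / S.Δ) • (!₂[(q.2.1 : ℝ), (q.2.2 : ℝ)] : Plane)‖ ^ 2 with hg
  set A := ((Finset.univ : Finset S.CoefIdx).filter (· ≠ S.originIdx)) ×ˢ
    (Finset.Icc (-(S.T : ℤ)) S.T ×ˢ Finset.Icc (-(S.T : ℤ)) S.T)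
  have hpos : ∀ q ∈ A, 0 < g q := by
    intro q hq
    have hq1 := (Finset.mem_filter.1 (Finset.mem_product.1 hq).1).2
    have := norm_pos_iff.2 (S.freq_add_ne_zero (S.not_dvd_of_ne_originIdx hq1) q.2)
    positivity
  rcases A.eq_empty_or_nonempty with hA | hA
  · refine ⟨1, one_pos, fun c hc l hl => ?_⟩
    have : (c, l) ∈ A := Finset.mem_product.2 ⟨Finset.mem_filter.2 ⟨Finset.mem_univ _, hc⟩, hl⟩
    rw [hA] at this
    exact absurd this (Finset.notMem_empty _)
  · obtain ⟨q, hq, hmin⟩ := A.exists_min_image g hA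
    exact ⟨g q, hpos q hq, fun c hc l hl => hmin (c, l)
      (Finset.mem_product.2 ⟨Finset.mem_filter.2 ⟨Finset.mem_univ _, hc⟩, hl⟩)⟩

section Prior

variable {S f} {h₁ : Plane → ℝ} {h₂ u : ℝ → ℝ} {a : ℝ} (hA : AssumptionA1 f h₁ h₂ u a)
  {p : ℕ} {F : Fin p → Plane → ℝ} (hX₁ : (S.X₁ F).rank = p)
  (hLam : ∀ ϑ, 0 < ϑ → ∀ c : S.CoefIdx, 0 < S.aliasDensity f ϑ (S.freq (S.coefFreqIdx c)))

include hLam in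
theorem lamEntry_pos {ϑ : ℝ} (hϑ : 0 < ϑ) (c : S.CoefIdx) : 0 < S.lamEntry f ϑ c := by
  have := S.Δ_pos
  have := Real.pi_pos
  exact mul_pos (by positivity) (hLam ϑ hϑ c)

include hLam in
theorem isUnit_det_Lam {ϑ : ℝ} (hϑ : 0 < ϑ) :
    IsUnit (Matrix.diagonal (S.lamEntry f ϑ)).det := by
  rw [Matrix.det_diagonal]
  exact (Finset.prod_pos fun c _ => lamEntry_pos hLam hϑ c).ne'.isUnit

include hX₁ hLam in
theorem isUnit_det_gram_Lam {ϑ : ℝ} (hϑ : 0 < ϑ) :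
    IsUnit ((S.X₁ F)ᵀ * (Matrix.diagonal (S.lamEntry f ϑ))⁻¹ * S.X₁ F).det :=
  isUnit_det_gram (Matrix.PosDef.diagonal (lamEntry_pos hLam hϑ)).inv (by simpa using hX₁)

include hA in
theorem hasDerivAt_lamEntry {ϑ : ℝ} (hϑ : 0 < ϑ) (c : S.CoefIdx) :
    HasDerivAt (fun t => S.lamEntry f t c) ((2 * Real.pi / S.Δ) ^ 2 *
      deriv (fun t => S.aliasDensity f t (S.freq (S.coefFreqIdx c))) ϑ) ϑ :=
  (hA.hasDerivAt_aliasDensity S hϑ _).differentiableAt.hasDerivAt.const_mul _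

include hA hX₁ hLam in
theorem continuousOn_approxRefPrior : ContinuousOn (S.approxRefPrior f F) (Ioi 0) := by
  -- By Cramer's rule the inverse is the adjugate divided by a nonvanishing determinant.
  have hinv : ∀ {m : Type} [Fintype m] [DecidableEq m] (A : Ioi (0 : ℝ) → Matrix m m ℝ),
      Continuous A → (∀ ϑ, IsUnit (A ϑ).det) → Continuous (fun ϑ => (A ϑ)⁻¹) := by
    intro m _ _ A hA hu
    simp only [Matrix.inv_def, Ring.inverse_eq_inv']
    exact (hA.matrix_det.inv₀ fun ϑ => (hu ϑ).ne_zero).smul hA.matrix_adjugate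
  have hL : Continuous (fun ϑ : Ioi (0 : ℝ) => Matrix.diagonal (S.lamEntry f ϑ)) := by
    refine Continuous.matrix_diagonal (continuous_pi fun c => ?_)
    exact continuous_const.mul (hA.continuousOn_aliasDensity S _).domRestrict
  have hLi := hinv _ hL fun ϑ => isUnit_det_Lam hLam ϑ.2
  have hG : Continuous (fun ϑ : Ioi (0 : ℝ) =>
      (S.X₁ F)ᵀ * (Matrix.diagonal (S.lamEntry f ϑ))⁻¹ * S.X₁ F) :=
    (continuous_const.matrix_mul hLi).matrix_mul continuous_const
  have hGi := hinv _ hG fun ϑ => isUnit_det_gram_Lam hX₁ hLam ϑ.2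
  have hQ : Continuous (fun ϑ : Ioi (0 : ℝ) => S.Q f F ϑ) :=
    hLi.sub ((((hLi.matrix_mul continuous_const).matrix_mul hGi).matrix_mul
      continuous_const).matrix_mul hLi)
  have hD : Continuous (fun ϑ : Ioi (0 : ℝ) => S.derivLam f ϑ) := by
    simp only [derivLam_eq]
    refine Continuous.matrix_diagonal (continuous_pi fun c => ?_)
    have : ContinuousOn (deriv fun t => S.lamEntry f t c) (Ioi 0) :=
      (continuousOn_const.mul (hA.continuousOn_deriv_aliasDensity S _)).congr
        fun ϑ hϑ => (hasDerivAt_lamEntry hA hϑ c).deriv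
    exact this.domRestrict
  have hDQ := hD.matrix_mul hQ
  have hDQ2 : Continuous (fun ϑ : Ioi (0 : ℝ) => (S.derivLam f ϑ * S.Q f F ϑ) ^ 2) := by
    simp only [pow_two]
    exact hDQ.matrix_mul hDQ
  exact continuousOn_iff_continuous_domRestrict.2
    (hDQ2.matrix_trace.sub (continuous_const.mul (hDQ.matrix_trace.pow 2))).sqrt

include hA hX₁ hLam in
/-- A bound for the prior from a bound for the deviation of the logarithmic derivatives of the
entries of `Λ̃_ϑ` from a common value. -/
theorem approxRefPrior_le (hp : 0 < p) (hintercept : ∀ x, F ⟨0, hp⟩ x = 1) (hpM : p < S.M)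
    {ϑ : ℝ} (hϑ : 0 < ϑ) {α β : ℝ} (hβ : 0 ≤ β)
    (hb : ∀ c : S.CoefIdx, c ≠ S.originIdx →
      ∀ l ∈ Finset.Icc (-(S.T : ℤ)) S.T ×ˢ Finset.Icc (-(S.T : ℤ)) S.T,
      |deriv h₂ ϑ / h₂ ϑ - a * deriv u ϑ / (‖S.freq (S.coefFreqIdx c) +
        (2 * Real.pi / S.Δ) • (!₂[(l.1 : ℝ), (l.2 : ℝ)] : Plane)‖ ^ 2 + u ϑ) - α| ≤ β) :
    S.approxRefPrior f F ϑ ≤ β * Real.sqrt (S.M - p) := by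
  have hD := isUnit_det_Lam hLam hϑ
  have hG := isUnit_det_gram_Lam hX₁ hLam hϑ
  have hlam := lamEntry_pos hLam hϑ
  have htr : (Matrix.diagonal (S.lamEntry f ϑ) * S.Q f F ϑ).trace = (S.M : ℝ) - p := by
    rw [Q_eq, trace_mul_glsResidual hD hG, card_coefIdx, Fintype.card_fin]
  have hpM' : (0 : ℝ) < S.M - p := sub_pos.2 (by exact_mod_cast hpM)
  have hQ0 := S.apply_originIdx_eq_zero hintercept (glsResidual_mul_design hG)
  have hQt : (S.Q f F ϑ)ᵀ = S.Q f F ϑ := glsResidual_transpose (Matrix.diagonal_transpose _)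
  have hdev : ∀ c, deriv (fun t => S.lamEntry f t c) ϑ = S.lamEntry f ϑ c *
      (deriv (fun t => S.lamEntry f t c) ϑ / S.lamEntry f ϑ c) := fun c => by
    field_simp [(hlam c).ne']
  have key := trace_sq_sub_sq_trace_le (Q := S.Q f F ϑ) (α := α) (β := β)
    (b := fun c => deriv (fun t => S.lamEntry f t c) ϑ / S.lamEntry f ϑ c)
    hlam hQt (glsResidual_mul_mul_self hD hG) (by rw [htr]; exact hpM') (fun c => by
      -- The deviation bound excludes the origin coefficient; there the column of `Q` vanishes, and
      -- by symmetry so does the row.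
      by_cases hc : c = S.originIdx
      · left
        intro c'
        have := congrFun (congrFun hQt c') c
        rw [Matrix.transpose_apply] at this
        rw [this, hc]
        exact hQ0 c'
      · right
        have h1 := hA.abs_deriv_aliasDensity_sub_le S hϑ _ (hb c hc)
        have hpos := hLam ϑ hϑ c
        have hk : (2 * Real.pi / S.Δ) ^ 2 ≠ 0 := by
          have := S.Δ_pos
          have := Real.pi_pos
          positivity
        rw [(hasDerivAt_lamEntry hA hϑ c).deriv, lamEntry, mul_div_mul_left _ _ hk,
          ← mul_le_mul_iff_left₀ hpos]
        refine le_trans (le_of_eq ?_) h1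
        rw [← abs_of_pos hpos, ← abs_mul, abs_of_pos hpos, sub_mul, div_mul_cancel₀ _ hpos.ne'])
  rw [← funext hdev, ← derivLam_eq, htr] at key
  calc S.approxRefPrior f F ϑ ≤ Real.sqrt (β ^ 2 * (S.M - p)) := Real.sqrt_le_sqrt key
    _ = β * Real.sqrt (S.M - p) := by rw [Real.sqrt_mul (sq_nonneg _), Real.sqrt_sq hβ]

include hA hX₁ hLam in
/-- The bound of the prior, uniform over all `ϑ > 0`. -/
theorem exists_approxRefPrior_le (hp : 0 < p) (hintercept : ∀ x, F ⟨0, hp⟩ x = 1)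
    (hpM : p < S.M) : ∃ C : ℝ, ∀ ϑ, 0 < ϑ →
      S.approxRefPrior f F ϑ ≤ C * min |deriv u ϑ| (|deriv u ϑ| / u ϑ ^ 2) := by
  obtain ⟨R, hR, hRle⟩ := S.exists_norm_alias_le
  obtain ⟨r, hr, hrle⟩ := S.exists_le_norm_alias
  refine ⟨max (|a| / r) (|a| * R) * Real.sqrt (S.M - p), fun ϑ hϑ => ?_⟩
  have hu := hA.u_pos ϑ hϑ
  set C := max (|a| / r) (|a| * R)
  have hC : 0 ≤ C := le_max_of_le_left (by positivity)
  -- Subtracting `h₂'/h₂` leaves `a u' / (x + u)`, and `x ≥ r` away from the origin coefficient.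
  have b1 : S.approxRefPrior f F ϑ ≤ (C * |deriv u ϑ|) * Real.sqrt (S.M - p) := by
    refine approxRefPrior_le hA hX₁ hLam hp hintercept hpM hϑ (α := deriv h₂ ϑ / h₂ ϑ)
      (by positivity) fun c hc l hl => ?_
    have hx := hrle c hc l hl
    set x := ‖S.freq (S.coefFreqIdx c) +
      (2 * Real.pi / S.Δ) • (!₂[(l.1 : ℝ), (l.2 : ℝ)] : Plane)‖ ^ 2
    have hxu : 0 < x + u ϑ := by linarith
    rw [sub_right_comm, sub_self, zero_sub, abs_neg, abs_div, abs_mul, abs_of_pos hxu]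
    calc |a| * |deriv u ϑ| / (x + u ϑ) ≤ |a| * |deriv u ϑ| / r :=
          div_le_div_of_nonneg_left (by positivity) hr (by linarith)
      _ = |a| / r * |deriv u ϑ| := by ring
      _ ≤ C * |deriv u ϑ| := mul_le_mul_of_nonneg_right (le_max_left _ _) (abs_nonneg _)
  -- Subtracting also the value at `x = 0` leaves `a u' x / ((x + u) u)`, with `x ≤ R` and `x + u ≥
  -- u`.
  have b2 : S.approxRefPrior f F ϑ
      ≤ (C * (|deriv u ϑ| / u ϑ ^ 2)) * Real.sqrt (S.M - p) := by
    refine approxRefPrior_le hA hX₁ hLam hp hintercept hpM hϑ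
      (α := deriv h₂ ϑ / h₂ ϑ - a * deriv u ϑ / u ϑ) (by positivity) fun c hc l hl => ?_
    have hx := hRle c l hl
    have hx0 : 0 ≤ ‖S.freq (S.coefFreqIdx c) +
      (2 * Real.pi / S.Δ) • (!₂[(l.1 : ℝ), (l.2 : ℝ)] : Plane)‖ ^ 2 := by positivity
    set x := ‖S.freq (S.coefFreqIdx c) +
      (2 * Real.pi / S.Δ) • (!₂[(l.1 : ℝ), (l.2 : ℝ)] : Plane)‖ ^ 2
    have hxu : 0 < x + u ϑ := by linarith
    have e : deriv h₂ ϑ / h₂ ϑ - a * deriv u ϑ / (x + u ϑ)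
        - (deriv h₂ ϑ / h₂ ϑ - a * deriv u ϑ / u ϑ)
        = a * deriv u ϑ * x / ((x + u ϑ) * u ϑ) := by
      field_simp; ring
    rw [e, abs_div, abs_mul, abs_mul, abs_of_nonneg hx0, abs_of_pos (mul_pos hxu hu)]
    calc |a| * |deriv u ϑ| * x / ((x + u ϑ) * u ϑ) ≤ |a| * |deriv u ϑ| * R / (u ϑ * u ϑ) := by
          gcongr; linarith
      _ = |a| * R * (|deriv u ϑ| / u ϑ ^ 2) := by ring
      _ ≤ C * (|deriv u ϑ| / u ϑ ^ 2) :=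
          mul_le_mul_of_nonneg_right (le_max_right _ _) (by positivity)
  rcases min_choice |deriv u ϑ| (|deriv u ϑ| / u ϑ ^ 2) with h | h <;> rw [h]
  · linarith
  · linarith

end Prior

end SpectralDesign

/-! ### Gaussian integrals over scales and translations. -/

section Gaussian

variable {n p : ℕ}

/-- The density at `w` of the centred normal distribution with covariance matrix `v A`. -/
def normalDensity (A : Matrix (Fin n) (Fin n) ℝ) (v : ℝ) (w : Fin n → ℝ) : ℝ :=
  (2 * Real.pi * v) ^ (-(n : ℝ) / 2) * A.det ^ (-(1 : ℝ) / 2) *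
    Real.exp (-(w ⬝ᵥ (A⁻¹ *ᵥ w)) / (2 * v))

theorem gaussianLikelihood_eq (K : ℝ → ℝ → ℝ) (s : Fin n → Plane) (F : Fin p → Plane → ℝ)
    (z : Fin n → ℝ) (β : Fin p → ℝ) (v ϑ : ℝ) :
    gaussianLikelihood K s F z β v ϑ
      = normalDensity (corrMatrix K s ϑ) v (z - designMatrix F s *ᵥ β) := rfl

/-- The density of the standard normal distribution. -/
def stdNormalDensity (x : Fin n → ℝ) : ℝ :=
  (2 * Real.pi) ^ (-(n : ℝ) / 2) * Real.exp (-(x ⬝ᵥ x) / 2)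

theorem normalDensity_nonneg {A : Matrix (Fin n) (Fin n) ℝ} (hA : A.PosDef) {v : ℝ} (hv : 0 < v)
    (w : Fin n → ℝ) : 0 ≤ normalDensity A v w := by
  have := hA.det_pos
  have := Real.pi_pos
  unfold normalDensity
  positivity

theorem integrable_stdNormalDensity : Integrable (stdNormalDensity (n := n)) := by
  have h : Integrable fun x : ℝ => Real.exp (-(1 / 2) * x ^ 2) :=
    integrable_exp_neg_mul_sq (by norm_num)
  have h2 := (Integrable.fintype_prod (ι := Fin n) (fun _ => h)).const_mul
    ((2 * Real.pi) ^ (-(n : ℝ) / 2))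
  refine h2.congr (ae_of_all _ fun x => ?_)
  simp only [stdNormalDensity, dotProduct, ← Real.exp_sum]
  congr 2
  rw [neg_div, Finset.sum_div, ← Finset.sum_neg_distrib]
  exact Finset.sum_congr rfl fun i _ => by ring

open scoped MatrixOrder in
theorem Matrix.PosDef.exists_eq_mul_transpose {A : Matrix (Fin n) (Fin n) ℝ} (hA : A.PosDef) :
    ∃ B : Matrix (Fin n) (Fin n) ℝ, A = B * Bᵀ := by
  obtain ⟨B, hB⟩ := CStarAlgebra.nonneg_iff_eq_star_mul_self.1 hA.posSemidef.nonneg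
  refine ⟨Bᵀ, ?_⟩
  rw [hB, Matrix.transpose_transpose, Matrix.star_eq_conjTranspose,
    Matrix.conjTranspose_eq_transpose_of_trivial]

theorem continuous_normalDensity (A : Matrix (Fin n) (Fin n) ℝ) (v : ℝ) :
    Continuous (normalDensity A v) := by
  unfold normalDensity
  have : Continuous fun w : Fin n → ℝ => w ⬝ᵥ (A⁻¹ *ᵥ w) :=
    continuous_id.dotProduct (continuous_const.matrix_mulVec continuous_id)
  fun_prop

/-- A normal distribution is a linear image of the standard one. -/
theorem lintegral_normalDensity_mul {A B : Matrix (Fin n) (Fin n) ℝ} (hA : A.PosDef)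
    (hB : A = B * Bᵀ) {v : ℝ} (hv : 0 < v) {G : (Fin n → ℝ) → ENNReal} (hG : Measurable G) :
    ∫⁻ w, ENNReal.ofReal (normalDensity A v w) * G w
      = ∫⁻ x, ENNReal.ofReal (stdNormalDensity x) * G (Real.sqrt v • (B *ᵥ x)) := by
  have hsv : 0 < Real.sqrt v := Real.sqrt_pos.2 hv
  have hdet : A.det = B.det ^ 2 := by rw [hB, Matrix.det_mul, Matrix.det_transpose, pow_two]
  have hdetA := hA.det_pos
  have hB0 : B.det ≠ 0 := fun h => by rw [hdet, h] at hdetA; simp at hdetA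
  set C := Real.sqrt v • B with hC
  have hdetC : C.det = Real.sqrt v ^ n * B.det := by
    rw [hC, Matrix.det_smul, Fintype.card_fin]
  have hC0 : C.det ≠ 0 := by rw [hdetC]; positivity
  have hCx : ∀ x, C *ᵥ x = Real.sqrt v • (B *ᵥ x) := fun x => by
    rw [hC, Matrix.smul_mulVec]
  have hmeasC : Measurable (Matrix.toLin' C) :=
    (LinearMap.continuous_of_finiteDimensional _).measurable
  -- Change of variables `w = C x`: the Jacobian `|det C|` cancels the powers of `v` and `det A` in
  -- the density.
  have hvol : (volume : Measure (Fin n → ℝ))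
      = ENNReal.ofReal |C.det| • Measure.map (Matrix.toLin' C) volume := by
    rw [Real.map_matrix_volume_pi_eq_smul_volume_pi hC0, smul_smul,
      ← ENNReal.ofReal_mul (abs_nonneg _), ← abs_mul, mul_inv_cancel₀ hC0, abs_one,
      ENNReal.ofReal_one, one_smul]
  have hquad : ∀ x, (C *ᵥ x) ⬝ᵥ (A⁻¹ *ᵥ (C *ᵥ x)) = v * (x ⬝ᵥ x) := by
    intro x
    have h1 : A⁻¹ *ᵥ (B *ᵥ x) = (Bᵀ)⁻¹ *ᵥ x := by
      rw [hB, Matrix.mul_inv_rev, Matrix.mulVec_mulVec, Matrix.mul_assoc,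
        Matrix.nonsing_inv_mul _ hB0.isUnit, Matrix.mul_one]
    rw [hCx, Matrix.mulVec_smul, h1, dotProduct_smul, smul_dotProduct, smul_smul,
      Real.mul_self_sqrt hv.le, Matrix.dotProduct_mulVec, ← Matrix.mulVec_transpose,
      ← Matrix.transpose_nonsing_inv, Matrix.transpose_transpose, Matrix.mulVec_mulVec,
      Matrix.nonsing_inv_mul _ hB0.isUnit, Matrix.one_mulVec, smul_eq_mul]
  have hdens : ∀ x, |C.det| * normalDensity A v (C *ᵥ x) = stdNormalDensity x := by
    intro x
    have hpi := Real.pi_pos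
    have e1 : |C.det| = v ^ ((n : ℝ) / 2) * |B.det| := by
      rw [hdetC, abs_mul, abs_of_pos (by positivity), Real.sqrt_eq_rpow, ← Real.rpow_mul_natCast
        hv.le]
      congr 2
      ring
    have e2 : A.det ^ (-(1 : ℝ) / 2) = |B.det|⁻¹ := by
      rw [hdet, ← sq_abs, ← Real.rpow_natCast, ← Real.rpow_mul (abs_nonneg _)]
      norm_num
      rw [Real.rpow_neg_one]
    have e3 : (2 * Real.pi * v) ^ (-(n : ℝ) / 2)
        = (2 * Real.pi) ^ (-(n : ℝ) / 2) * (v ^ ((n : ℝ) / 2))⁻¹ := by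
      rw [Real.mul_rpow (by positivity) hv.le, ← Real.rpow_neg hv.le, neg_div]
    have e4 : -(v * (x ⬝ᵥ x)) / (2 * v) = -(x ⬝ᵥ x) / 2 := by
      field_simp
    have hv' : v ^ ((n : ℝ) / 2) ≠ 0 := (Real.rpow_pos_of_pos hv _).ne'
    have hB' : |B.det| ≠ 0 := abs_ne_zero.2 hB0
    rw [normalDensity, hquad, e1, e2, e3, e4, stdNormalDensity]
    field_simp
  have hm : Measurable fun w => ENNReal.ofReal (normalDensity A v w) * G w :=
    (ENNReal.measurable_ofReal.comp (continuous_normalDensity A v).measurable).mul hG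
  conv_lhs => rw [hvol]
  rw [lintegral_smul_measure, lintegral_map hm hmeasC, smul_eq_mul,
    ← lintegral_const_mul _ (by exact hm.comp hmeasC)]
  refine lintegral_congr fun x => ?_
  rw [Matrix.toLin'_apply, ← mul_assoc, ← ENNReal.ofReal_mul (abs_nonneg _), hdens, hCx]

/-- The indicator of an annulus. -/
def annulusIndicator (r R : ℝ) : (Fin n → ℝ) → ENNReal :=
  {y | r < ‖y‖ ∧ ‖y‖ < R}.indicator 1

theorem measurable_annulusIndicator (r R : ℝ) :
    Measurable (annulusIndicator r R : (Fin n → ℝ) → ENNReal) :=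
  measurable_one.indicator ((measurableSet_lt measurable_const measurable_norm).inter
    (measurableSet_lt measurable_norm measurable_const))

/-- The measure `dv / v` of the scales carrying a vector into an annulus is bounded. -/
theorem lintegral_scale_annulusIndicator_le {r R : ℝ} (hr : 0 < r) (hrR : r < R)
    (y : Fin n → ℝ) :
    ∫⁻ v in Ioi 0, ENNReal.ofReal (1 / v) * annulusIndicator r R (Real.sqrt v • y)
      ≤ ENNReal.ofReal (R ^ 2 / r ^ 2) := by
  have hR : 0 < R := hr.trans hrR
  -- The zero vector never enters the annulus, since `r > 0`.
  by_cases hy : y = 0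
  · subst hy
    have : ∀ v : ℝ, annulusIndicator r R (Real.sqrt v • (0 : Fin n → ℝ)) = 0 := by
      intro v
      simp [annulusIndicator, not_lt.2 hr.le]
    simp only [this, mul_zero, lintegral_zero, zero_le]
  have hy0 : 0 < ‖y‖ := norm_pos_iff.2 hy
  -- The admissible scales form this interval, on which `1 / v` is at most `‖y‖² / r²`. The product
  -- of this bound and the length of `V` no longer involves `y`.
  set V := Ioo (r ^ 2 / ‖y‖ ^ 2) (R ^ 2 / ‖y‖ ^ 2)
  have hle : ∀ v ∈ Ioi (0 : ℝ), ENNReal.ofReal (1 / v) * annulusIndicator r R (Real.sqrt v • y)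
      ≤ V.indicator (fun _ => ENNReal.ofReal (‖y‖ ^ 2 / r ^ 2)) v := by
    intro v hv
    have hv0 : 0 < v := hv
    by_cases h : Real.sqrt v • y ∈ {y : Fin n → ℝ | r < ‖y‖ ∧ ‖y‖ < R}
    · obtain ⟨h1, h2⟩ := h
      rw [norm_smul, Real.norm_of_nonneg (Real.sqrt_nonneg _)] at h1 h2
      have hsq : (Real.sqrt v * ‖y‖) ^ 2 = v * ‖y‖ ^ 2 := by
        rw [mul_pow, Real.sq_sqrt hv0.le]
      have h1' : r ^ 2 < v * ‖y‖ ^ 2 := by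
        rw [← hsq]; exact pow_lt_pow_left₀ h1 hr.le two_ne_zero
      have h2' : v * ‖y‖ ^ 2 < R ^ 2 := by
        rw [← hsq]; exact pow_lt_pow_left₀ h2 (by positivity) two_ne_zero
      have hvV : v ∈ V := ⟨by rw [div_lt_iff₀ (by positivity)]; exact h1',
        by rw [lt_div_iff₀ (by positivity)]; exact h2'⟩
      rw [indicator_of_mem hvV]
      calc ENNReal.ofReal (1 / v) * annulusIndicator r R (Real.sqrt v • y)
          ≤ ENNReal.ofReal (1 / v) * 1 := by
            gcongr; exact indicator_le_self' (fun _ _ => zero_le) _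
        _ ≤ ENNReal.ofReal (‖y‖ ^ 2 / r ^ 2) := by
            rw [mul_one]
            apply ENNReal.ofReal_le_ofReal
            rw [div_le_div_iff₀ hv0 (by positivity)]
            linarith
    · rw [annulusIndicator, indicator_of_notMem h, mul_zero]
      exact zero_le
  calc _ ≤ ∫⁻ v in Ioi 0, V.indicator (fun _ => ENNReal.ofReal (‖y‖ ^ 2 / r ^ 2)) v :=
        setLIntegral_mono' measurableSet_Ioi hle
    _ ≤ ∫⁻ v, V.indicator (fun _ => ENNReal.ofReal (‖y‖ ^ 2 / r ^ 2)) v :=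
        setLIntegral_le_lintegral _ _
    _ = ENNReal.ofReal (‖y‖ ^ 2 / r ^ 2) *
          ENNReal.ofReal (R ^ 2 / ‖y‖ ^ 2 - r ^ 2 / ‖y‖ ^ 2) := by
        rw [lintegral_indicator_const measurableSet_Ioo, Real.volume_Ioo]
    _ ≤ ENNReal.ofReal (R ^ 2 / r ^ 2) := by
        rw [← ENNReal.ofReal_mul (by positivity)]
        apply ENNReal.ofReal_le_ofReal
        have : ‖y‖ ^ 2 / r ^ 2 * (R ^ 2 / ‖y‖ ^ 2 - r ^ 2 / ‖y‖ ^ 2) = R ^ 2 / r ^ 2 - 1 := by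
          field_simp
        linarith

/-- Integrated against `dv / v`, the normal distributions with covariances `v A` have on the
preimage of an annulus a total mass bounded independently of `A`. -/
theorem lintegral_normalDensity_annulus_le {A : Matrix (Fin n) (Fin n) ℝ} (hA : A.PosDef)
    (N : Matrix (Fin n) (Fin n) ℝ) {r R : ℝ} (hr : 0 < r) (hrR : r < R) :
    ∫⁻ v in Ioi 0, ENNReal.ofReal (1 / v) *
        ∫⁻ w, ENNReal.ofReal (normalDensity A v w) * annulusIndicator r R (N *ᵥ w)
      ≤ ENNReal.ofReal (R ^ 2 / r ^ 2) *
        ∫⁻ x : Fin n → ℝ, ENNReal.ofReal (stdNormalDensity x) := by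
  obtain ⟨B, hB⟩ := hA.exists_eq_mul_transpose
  have hmul : ∀ C : Matrix (Fin n) (Fin n) ℝ, Measurable fun w : Fin n → ℝ => C *ᵥ w := fun C =>
    (continuous_const.matrix_mulVec continuous_id).measurable
  have hstd : Measurable (stdNormalDensity (n := n)) := by
    unfold stdNormalDensity
    have : Continuous fun w : Fin n → ℝ => w ⬝ᵥ w := continuous_id.dotProduct continuous_id
    fun_prop
  have hscale : ∀ v : ℝ, ∀ x : Fin n → ℝ,
      N *ᵥ (Real.sqrt v • (B *ᵥ x)) = Real.sqrt v • ((N * B) *ᵥ x) := fun v x => by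
    rw [Matrix.mulVec_smul, Matrix.mulVec_mulVec]
  have hmeas : Measurable fun q : ℝ × (Fin n → ℝ) =>
      annulusIndicator r R (Real.sqrt q.1 • ((N * B) *ᵥ q.2)) :=
    (measurable_annulusIndicator r R).comp
      ((Real.continuous_sqrt.measurable.comp measurable_fst).smul
        ((hmul _).comp measurable_snd))
  calc _ = ∫⁻ v in Ioi 0, ∫⁻ x, ENNReal.ofReal (stdNormalDensity x) *
          (ENNReal.ofReal (1 / v) * annulusIndicator r R (Real.sqrt v • ((N * B) *ᵥ x))) := by
        refine setLIntegral_congr_fun measurableSet_Ioi fun v hv => ?_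
        rw [lintegral_normalDensity_mul hA hB hv (G := fun w => annulusIndicator r R (N *ᵥ w))
          ((measurable_annulusIndicator r R).comp (hmul N)),
          ← lintegral_const_mul]
        · refine lintegral_congr fun x => ?_
          rw [hscale]
          ring
        · refine (ENNReal.measurable_ofReal.comp hstd).mul ?_
          exact ((measurable_annulusIndicator r R).comp (hmul N)).comp
            ((hmul B).const_smul (Real.sqrt v))
    -- With `x` fixed, the covariance enters only through the vector `N B x`, and the scale bound is
    -- uniform in that vector.
    _ = ∫⁻ x, ∫⁻ v in Ioi 0, ENNReal.ofReal (stdNormalDensity x) *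
          (ENNReal.ofReal (1 / v) * annulusIndicator r R (Real.sqrt v • ((N * B) *ᵥ x))) := by
        refine lintegral_lintegral_swap (Measurable.aemeasurable ?_)
        refine (ENNReal.measurable_ofReal.comp (hstd.comp measurable_snd)).mul
          (Measurable.mul ?_ hmeas)
        exact ENNReal.measurable_ofReal.comp (measurable_const.div measurable_fst)
    _ ≤ ∫⁻ x : Fin n → ℝ, ENNReal.ofReal (R ^ 2 / r ^ 2) *
          ENNReal.ofReal (stdNormalDensity x) := by
        refine lintegral_mono fun x => ?_
        have hm : Measurable fun v : ℝ =>
            ENNReal.ofReal (1 / v) * annulusIndicator r R (Real.sqrt v • ((N * B) *ᵥ x)) :=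
          (ENNReal.measurable_ofReal.comp (measurable_const.div measurable_id)).mul
            ((measurable_annulusIndicator r R).comp
              (Real.continuous_sqrt.measurable.smul_const _))
        rw [lintegral_const_mul _ hm, mul_comm]
        gcongr
        exact lintegral_scale_annulusIndicator_le hr hrR _
    _ = _ := lintegral_const_mul _ (ENNReal.measurable_ofReal.comp hstd)

/-- Averaging over the translates along the range of `X`. -/
theorem lintegral_lintegral_translate {X : Matrix (Fin n) (Fin p) ℝ}
    {P : Matrix (Fin p) (Fin n) ℝ} (hPX : P * X = 1) {g₁ : (Fin n → ℝ) → ENNReal}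
    {g₂ : (Fin p → ℝ) → ENNReal} {H : (Fin n → ℝ) → ENNReal} (hg₁ : Measurable g₁)
    (hg₂ : Measurable g₂) (hH : Measurable H) :
    ∫⁻ β : Fin p → ℝ, ∫⁻ z, H (z - X *ᵥ β) * (g₁ ((1 - X * P) *ᵥ z) * g₂ (P *ᵥ z))
      = (∫⁻ β, g₂ β) * ∫⁻ w, H w * g₁ ((1 - X * P) *ᵥ w) := by
  have hmN : Measurable fun w : Fin n → ℝ => (1 - X * P) *ᵥ w :=
    (continuous_const.matrix_mulVec continuous_id).measurable
  have hmP : Measurable fun w : Fin n → ℝ => P *ᵥ w :=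
    (continuous_const.matrix_mulVec continuous_id).measurable
  have hN : ∀ z β, (1 - X * P) *ᵥ (z + X *ᵥ β) = (1 - X * P) *ᵥ z := by
    intro z β
    rw [Matrix.mulVec_add, Matrix.mulVec_mulVec, Matrix.sub_mul, Matrix.mul_assoc, hPX,
      Matrix.one_mul, Matrix.mul_one, sub_self, Matrix.zero_mulVec, add_zero]
  have hP : ∀ z β, P *ᵥ (z + X *ᵥ β) = P *ᵥ z + β := by
    intro z β
    rw [Matrix.mulVec_add, Matrix.mulVec_mulVec, hPX, Matrix.one_mulVec]
  calc _ = ∫⁻ β : Fin p → ℝ, ∫⁻ z, H z * (g₁ ((1 - X * P) *ᵥ z) * g₂ (P *ᵥ z + β)) := by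
        refine lintegral_congr fun β => ?_
        -- Translating `z` by `X β` leaves `(1 - X P) z` unchanged and moves `P z` by `β`.
        rw [← lintegral_add_right_eq_self _ (X *ᵥ β)]
        simp only [add_sub_cancel_right, hN, hP]
    _ = ∫⁻ z, ∫⁻ β : Fin p → ℝ, H z * (g₁ ((1 - X * P) *ᵥ z) * g₂ (P *ᵥ z + β)) := by
        refine lintegral_lintegral_swap (Measurable.aemeasurable ?_)
        exact (hH.comp measurable_snd).mul ((hg₁.comp (hmN.comp measurable_snd)).mul
          (hg₂.comp ((hmP.comp measurable_snd).add measurable_fst)))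
    _ = ∫⁻ w, (∫⁻ β, g₂ β) * (H w * g₁ ((1 - X * P) *ᵥ w)) := by
        refine lintegral_congr fun z => ?_
        have hm : Measurable fun β => g₂ (P *ᵥ z + β) := hg₂.comp (measurable_const_add _)
        simp only [← mul_assoc]
        rw [lintegral_const_mul _ hm, lintegral_add_left_eq_self g₂]
        ring
    _ = _ := lintegral_const_mul _ (hH.mul (hg₁.comp hmN))

/-- Joint measurability of the normal density in all its arguments. -/
theorem Measurable.normalDensity {α : Type*} [MeasurableSpace α] {A : α → Fin n → Fin n → ℝ}
    {v : α → ℝ} {w : α → Fin n → ℝ} (hA : Measurable A) (hv : Measurable v) (hw : Measurable w) :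
    Measurable fun x => _root_.normalDensity (Matrix.of (A x)) (v x) (w x) := by
  have hof : Continuous fun B : Fin n → Fin n → ℝ => Matrix.of B := continuous_id
  have hdet' : Continuous fun B : Fin n → Fin n → ℝ => (Matrix.of B).det := hof.matrix_det
  have hadj' : ∀ i j, Continuous fun B : Fin n → Fin n → ℝ => (Matrix.of B).adjugate i j :=
    hof.matrix_adjugate.matrix_elem
  have hdet : Measurable fun x => (Matrix.of (A x)).det := hdet'.measurable.comp hA
  have hadj : ∀ i j, Measurable fun x => (Matrix.of (A x)).adjugate i j := fun i j =>
    (hadj' i j).measurable.comp hA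
  have hw' : ∀ i, Measurable fun x => w x i := fun i => (measurable_pi_apply i).comp hw
  have hquad : Measurable fun x => w x ⬝ᵥ ((Matrix.of (A x))⁻¹ *ᵥ w x) := by
    simp only [dotProduct, Matrix.mulVec, Matrix.inv_def, Ring.inverse_eq_inv',
      Matrix.smul_apply, smul_eq_mul]
    exact Finset.measurable_fun_sum _ fun i _ => (hw' i).mul
      (Finset.measurable_fun_sum _ fun j _ => (hdet.inv.mul (hadj i j)).mul (hw' j))
  unfold _root_.normalDensity
  exact (((hv.const_mul _).pow_const _).mul (hdet.pow_const _)).mul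
    ((hquad.neg.div (hv.const_mul _)).exp)

end Gaussian

/-! ### Independence of characters of the plane. -/

section Characters

/-- The character `ω ↦ exp (i ω · s)` of the plane. -/
def planeChar (s : Plane) : Multiplicative Plane →* ℂ where
  toFun ω := Complex.exp (Complex.I * ((inner ℝ ω.toAdd s : ℝ) : ℂ))
  map_one' := by simp
  map_mul' x y := by
    rw [← Complex.exp_add, toAdd_mul, inner_add_left]
    push_cast
    ring_nf

theorem planeChar_apply (s ω : Plane) : planeChar s (Multiplicative.ofAdd ω)
    = Complex.exp (Complex.I * ((inner ℝ ω s : ℝ) : ℂ)) := rfl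

theorem planeChar_injective : Function.Injective planeChar := by
  intro s t h
  by_contra hst
  have hd : inner ℝ (s - t) (s - t) ≠ 0 := inner_self_ne_zero.2 (sub_ne_zero.2 hst)
  set d := inner ℝ (s - t) (s - t) with hdef
  -- At this frequency the two characters have ratio `exp (i π) = -1`.
  have h1 := DFunLike.congr_fun h (Multiplicative.ofAdd ((Real.pi / d) • (s - t)))
  rw [planeChar_apply, planeChar_apply, Complex.exp_eq_exp_iff_exp_sub_eq_one] at h1
  have h2 : Complex.I * ((inner ℝ ((Real.pi / d) • (s - t)) s : ℝ) : ℂ)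
      - Complex.I * ((inner ℝ ((Real.pi / d) • (s - t)) t : ℝ) : ℂ) = Real.pi * Complex.I := by
    rw [← mul_sub, ← Complex.ofReal_sub, ← inner_sub_right, inner_smul_left, ← hdef]
    simp [div_mul_cancel₀ _ hd, mul_comm]
  rw [h2, Complex.exp_pi_mul_I] at h1
  norm_num at h1

/-- A nontrivial trigonometric sum vanishes on no nonempty open set. -/
theorem exists_trigSum_ne_zero {n : ℕ} {s : Fin n → Plane} (hs : Function.Injective s)
    {x : Fin n → ℝ} (hx : x ≠ 0) {U : Set Plane} (hU : IsOpen U) (hne : U.Nonempty) :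
    ∃ ω ∈ U, ∑ i, (x i : ℂ) * Complex.exp (Complex.I * ((inner ℝ ω (s i) : ℝ) : ℂ)) ≠ 0 := by
  by_contra! h
  obtain ⟨ω₀, hω₀⟩ := hne
  have hinner : ∀ i, AnalyticOnNhd ℝ
      (fun ω : Plane => Complex.I * ((inner ℝ ω (s i) : ℝ) : ℂ)) univ := by
    intro i
    have h1 : AnalyticOnNhd ℝ (fun ω : Plane => ((inner ℝ (s i) ω : ℝ) : ℂ)) univ :=
      (Complex.ofRealCLM.comp (innerSL ℝ (s i))).analyticOnNhd _
    simp only [fun ω : Plane => real_inner_comm (s i) ω]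
    exact analyticOnNhd_const.mul h1
  have han : AnalyticOnNhd ℝ (fun ω : Plane =>
      ∑ i, (x i : ℂ) * Complex.exp (Complex.I * ((inner ℝ ω (s i) : ℝ) : ℂ))) univ := by
    refine Finset.analyticOnNhd_fun_sum _ fun i _ => analyticOnNhd_const.mul ?_
    exact (analyticOnNhd_cexp.restrictScalars (𝕜 := ℝ)).comp (hinner i) (mapsTo_univ _ _)
  -- Analyticity spreads the vanishing from `U` to the whole plane, where Dedekind's independence of
  -- characters applies.
  have hzero := han.eqOn_zero_of_preconnected_of_eventuallyEq_zero isPreconnected_univ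
    (mem_univ ω₀) (by filter_upwards [hU.mem_nhds hω₀] with ω hω using h ω hω)
  have hli := (linearIndependent_monoidHom (Multiplicative Plane) ℂ).comp
    (fun i => planeChar (s i)) (planeChar_injective.comp hs)
  have hcoef := Fintype.linearIndependent_iff.1 hli (fun i => (x i : ℂ)) (by
    ext ω
    rw [Finset.sum_apply]
    exact hzero (mem_univ ω.toAdd))
  exact hx (funext fun i => by exact_mod_cast hcoef i)

end Characters

/-! ### Positive definiteness and measurability of the correlation matrix. -/

section Correlation

variable {f : ℝ → Plane → ℝ} {h₁ : Plane → ℝ} {h₂ u : ℝ → ℝ} {a : ℝ} {K : ℝ → ℝ → ℝ}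

/-- The integral of a nonintegrable function is `0` by convention, so the value `1` forces
integrability. -/
theorem AssumptionA1.integrable_density (hA : AssumptionA1 f h₁ h₂ u a) {ϑ : ℝ} (hϑ : 0 < ϑ) :
    Integrable (f ϑ) := by
  by_contra h
  have := hA.integral_eq_one ϑ hϑ
  rw [integral_undef h] at this
  exact zero_ne_one this

theorem AssumptionA1.continuous_density (hA : AssumptionA1 f h₁ h₂ u a) {ϑ : ℝ} (hϑ : 0 < ϑ) :
    Continuous (f ϑ) := by
  rw [funext (hA.form ϑ hϑ)]
  refine (hA.h₁_continuous.mul continuous_const).div ?_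
    fun ω => (Real.rpow_pos_of_pos (hA.denom_pos hϑ ω) a).ne'
  exact ((continuous_norm.pow 2).add continuous_const).rpow_const
    fun ω => Or.inl (hA.denom_pos hϑ ω).ne'

/-- The quadratic form of the correlation matrix, in the spectral domain. -/
theorem quadForm_corrMatrix (hA : AssumptionA1 f h₁ h₂ u a) (hK : IsCorrelationWithDensity K f)
    {n : ℕ} (s : Fin n → Plane) {ϑ : ℝ} (hϑ : 0 < ϑ) (x : Fin n → ℝ) :
    x ⬝ᵥ (corrMatrix K s ϑ *ᵥ x) = ∫ ω, Complex.normSq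
      (∑ i, (x i : ℂ) * Complex.exp (Complex.I * ((inner ℝ ω (s i) : ℝ) : ℂ))) * f ϑ ω := by
  have hfi : Integrable fun ω => ((f ϑ ω : ℝ) : ℂ) := (hA.integrable_density hϑ).ofReal
  have hterm : ∀ h : Plane, Integrable fun ω : Plane =>
      Complex.exp (Complex.I * ((inner ℝ ω h : ℝ) : ℂ)) * ((f ϑ ω : ℝ) : ℂ) := by
    intro h
    refine hfi.bdd_mul (c := 1) ?_ (ae_of_all _ fun ω => ?_)
    · refine Continuous.aestronglyMeasurable ?_
      fun_prop
    · rw [mul_comm, Complex.norm_exp_ofReal_mul_I]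
  apply Complex.ofReal_injective
  rw [← integral_complex_ofReal]
  have hexp : ∀ ω : Plane, ((Complex.normSq
      (∑ i, (x i : ℂ) * Complex.exp (Complex.I * ((inner ℝ ω (s i) : ℝ) : ℂ))) * f ϑ ω : ℝ) : ℂ)
      = ∑ i, ∑ j, (x i * x j : ℂ) *
        (Complex.exp (Complex.I * ((inner ℝ ω (s i - s j) : ℝ) : ℂ)) * ((f ϑ ω : ℝ) : ℂ)) := by
    intro ω
    rw [Complex.ofReal_mul, ← Complex.mul_conj, map_sum, Finset.sum_mul_sum, Finset.sum_mul]
    refine Finset.sum_congr rfl fun i _ => ?_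
    rw [Finset.sum_mul]
    refine Finset.sum_congr rfl fun j _ => ?_
    rw [map_mul, ← Complex.exp_conj, map_mul, Complex.conj_I, Complex.conj_ofReal,
      Complex.conj_ofReal, inner_sub_right, Complex.ofReal_sub, mul_sub, sub_eq_add_neg,
      Complex.exp_add, neg_mul]
    ring
  simp only [hexp]
  rw [integral_finsetSum _ fun i _ => integrable_finsetSum _ fun j _ =>
    (hterm _).const_mul _]
  simp only [dotProduct, Matrix.mulVec, Complex.ofReal_sum, Complex.ofReal_mul]
  refine Finset.sum_congr rfl fun i _ => ?_
  rw [integral_finsetSum _ fun j _ => (hterm _).const_mul _, Finset.mul_sum]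
  refine Finset.sum_congr rfl fun j _ => ?_
  rw [integral_const_mul, ← hK ϑ hϑ, corrMatrix, Matrix.of_apply]
  ring

/-- The quadratic form integrates `|t|² f`, with `t` a nontrivial trigonometric sum. The continuous
density is positive on a nonempty open set, where `t` cannot vanish identically. -/
theorem posDef_corrMatrix (hA : AssumptionA1 f h₁ h₂ u a) (hK : IsCorrelationWithDensity K f)
    {n : ℕ} {s : Fin n → Plane} (hs : Function.Injective s) {ϑ : ℝ} (hϑ : 0 < ϑ) :
    (corrMatrix K s ϑ).PosDef := by
  refine Matrix.PosDef.of_dotProduct_mulVec_pos ?_ fun x hx => ?_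
  · ext i j
    simp [corrMatrix, norm_sub_rev]
  rw [star_trivial, quadForm_corrMatrix hA hK s hϑ]
  set t : Plane → ℂ := fun ω =>
    ∑ i, (x i : ℂ) * Complex.exp (Complex.I * ((inner ℝ ω (s i) : ℝ) : ℂ)) with ht
  have htc : Continuous t := by fun_prop
  have hfc := hA.continuous_density hϑ
  have hfi := hA.integrable_density hϑ
  have hU : IsOpen {ω | 0 < f ϑ ω} := isOpen_lt continuous_const hfc
  have hne : {ω | 0 < f ϑ ω}.Nonempty := by
    by_contra h
    rw [not_nonempty_iff_eq_empty, eq_empty_iff_forall_notMem] at h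
    have h0 : ∀ ω, f ϑ ω = 0 := fun ω =>
      le_antisymm (not_lt.1 (h ω)) (hA.density_nonneg hϑ ω)
    have := hA.integral_eq_one ϑ hϑ
    simp [h0] at this
  obtain ⟨ω, hω, htω⟩ := exists_trigSum_ne_zero hs hx hU hne
  have hgc : Continuous fun ω => Complex.normSq (t ω) * f ϑ ω :=
    (Complex.continuous_normSq.comp htc).mul hfc
  have hgi : Integrable fun ω => Complex.normSq (t ω) * f ϑ ω := by
    refine hfi.bdd_mul (c := (∑ i, |x i|) ^ 2)
      (Complex.continuous_normSq.comp htc).aestronglyMeasurable (ae_of_all _ fun ω => ?_)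
    rw [Real.norm_of_nonneg (Complex.normSq_nonneg _), Complex.normSq_eq_norm_sq]
    refine pow_le_pow_left₀ (norm_nonneg _) ((norm_sum_le _ _).trans (le_of_eq ?_)) 2
    refine Finset.sum_congr rfl fun i _ => ?_
    rw [norm_mul, mul_comm Complex.I, Complex.norm_exp_ofReal_mul_I, mul_one, Complex.norm_real,
      Real.norm_eq_abs]
  have hg0 : 0 ≤ fun ω => Complex.normSq (t ω) * f ϑ ω := fun ω =>
    mul_nonneg (Complex.normSq_nonneg _) (hA.density_nonneg hϑ ω)
  rw [integral_pos_iff_support_of_nonneg hg0 hgi]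
  refine hgc.isOpen_support.measure_pos _ ⟨ω, ?_⟩
  exact mul_ne_zero (fun h => htω (Complex.normSq_eq_zero.1 h)) (ne_of_gt hω)

/-- The correlation matrix depends measurably on `ϑ > 0`. -/
theorem exists_measurable_eq_corrMatrix (hA : AssumptionA1 f h₁ h₂ u a)
    (hK : IsCorrelationWithDensity K f) {n : ℕ} (s : Fin n → Plane) :
    ∃ Sig : ℝ → Fin n → Fin n → ℝ, Measurable Sig ∧
      ∀ ϑ, 0 < ϑ → Matrix.of (Sig ϑ) = corrMatrix K s ϑ := by
  have hext : ∀ g : ℝ → ℝ, ContinuousOn g (Ioi 0) → Measurable ((Ioi (0 : ℝ)).indicator g) := by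
    intro g hg
    rw [← piecewise_eq_indicator]
    exact hg.measurable_piecewise continuousOn_const measurableSet_Ioi
  have hh := hext h₂ hA.h₂_contDiff.continuousOn
  have hu := hext u hA.u_contDiff.continuousOn
  -- Extending `h₂` and `u` by zero to nonpositive `ϑ` gives a jointly measurable density that
  -- agrees with `f` for `ϑ > 0`.
  set g : ℝ → Plane → ℝ := fun ϑ ω =>
    h₁ ω * (Ioi (0 : ℝ)).indicator h₂ ϑ / (‖ω‖ ^ 2 + (Ioi (0 : ℝ)).indicator u ϑ) ^ a with hg
  have hgm : Measurable (Function.uncurry g) := by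
    refine ((hA.h₁_continuous.measurable.comp measurable_snd).mul
      (hh.comp measurable_fst)).div ?_
    exact ((measurable_snd.norm.pow_const 2).add (hu.comp measurable_fst)).pow_const a
  have hint : ∀ h : Plane, StronglyMeasurable fun ϑ : ℝ =>
      ∫ ω : Plane, Complex.exp (Complex.I * ((inner ℝ ω h : ℝ) : ℂ)) * ((g ϑ ω : ℝ) : ℂ) := by
    intro h
    refine MeasureTheory.StronglyMeasurable.integral_prod_right (f := fun ϑ (ω : Plane) =>
      Complex.exp (Complex.I * ((inner ℝ ω h : ℝ) : ℂ)) * ((g ϑ ω : ℝ) : ℂ))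
      (Measurable.stronglyMeasurable ?_)
    refine Measurable.mul ?_ (Complex.measurable_ofReal.comp hgm)
    have : Continuous fun ω : Plane => Complex.exp (Complex.I * ((inner ℝ ω h : ℝ) : ℂ)) := by
      fun_prop
    exact this.measurable.comp measurable_snd
  refine ⟨fun ϑ i j => (∫ ω : Plane, Complex.exp (Complex.I *
    ((inner ℝ ω (s i - s j) : ℝ) : ℂ)) * ((g ϑ ω : ℝ) : ℂ)).re, ?_, fun ϑ hϑ => ?_⟩
  · exact measurable_pi_iff.2 fun i => measurable_pi_iff.2 fun j =>
      Complex.measurable_re.comp (hint _).measurable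
  · have hgf : g ϑ = f ϑ := by
      funext ω
      rw [hg, hA.form ϑ hϑ]
      simp only [indicator_of_mem (mem_Ioi.2 hϑ)]
    ext i j
    change (∫ ω : Plane, Complex.exp (Complex.I * ((inner ℝ ω (s i - s j) : ℝ) : ℂ)) *
      ((g ϑ ω : ℝ) : ℂ)).re = K ϑ ‖s i - s j‖
    rw [hgf, ← hK ϑ hϑ, Complex.ofReal_re]

end Correlation

/-! ### Propriety of the posterior by averaging over the data. -/

section Posterior

variable {n p : ℕ}

/-- The unnormalized posterior of `(β, σ², ϑ)` under the prior `w(ϑ) / σ²`, with values in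
`[0, ∞]`. -/
def posteriorDensity (Sig : ℝ → Fin n → Fin n → ℝ) (X : Matrix (Fin n) (Fin p) ℝ)
    (w : ℝ → ENNReal) (z : Fin n → ℝ) (θ : (Fin p → ℝ) × ℝ × ℝ) : ENNReal :=
  ENNReal.ofReal (normalDensity (Matrix.of (Sig θ.2.2)) θ.2.1 (z - X *ᵥ θ.1)) *
    (ENNReal.ofReal (1 / θ.2.1) * w θ.2.2)

variable {Sig : ℝ → Fin n → Fin n → ℝ} {X : Matrix (Fin n) (Fin p) ℝ} {w : ℝ → ENNReal}

theorem measurable_posteriorDensity (hSig : Measurable Sig) (hw : Measurable w) :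
    Measurable fun q : (Fin n → ℝ) × ((Fin p → ℝ) × ℝ × ℝ) =>
      posteriorDensity Sig X w q.1 q.2 := by
  have hX : Measurable fun β : Fin p → ℝ => X *ᵥ β :=
    (continuous_const.matrix_mulVec continuous_id).measurable
  have h1 : Measurable fun q : (Fin n → ℝ) × ((Fin p → ℝ) × ℝ × ℝ) => q.2.2.2 :=
    measurable_snd.snd.snd
  have h2 : Measurable fun q : (Fin n → ℝ) × ((Fin p → ℝ) × ℝ × ℝ) => q.2.2.1 :=
    measurable_snd.snd.fst
  have h3 : Measurable fun q : (Fin n → ℝ) × ((Fin p → ℝ) × ℝ × ℝ) => q.1 - X *ᵥ q.2.1 :=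
    measurable_fst.sub (hX.comp measurable_snd.fst)
  exact (ENNReal.measurable_ofReal.comp (Measurable.normalDensity (hSig.comp h1) h2 h3)).mul
    ((ENNReal.measurable_ofReal.comp (measurable_const.div h2)).mul (hw.comp h1))

/-- The parameter space `ℝ^p × (0, ∞) × (0, ∞)` with Lebesgue measure. -/
theorem volume_restrict_paramSpace :
    (volume : Measure ((Fin p → ℝ) × ℝ × ℝ)).restrict (univ ×ˢ Ioi 0 ×ˢ Ioi 0)
      = (volume : Measure (Fin p → ℝ)).prod
        ((volume.restrict (Ioi 0)).prod (volume.restrict (Ioi 0))) := by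
  rw [Measure.volume_eq_prod, ← Measure.prod_restrict, Measure.volume_eq_prod,
    ← Measure.prod_restrict, Measure.restrict_univ]

/-- The weight functions on the data space against which the posterior masses are averaged. -/
def dataWeight (X : Matrix (Fin n) (Fin p) ℝ) (P : Matrix (Fin p) (Fin n) ℝ) (r R : ℝ)
    (z : Fin n → ℝ) : ENNReal :=
  annulusIndicator r R ((1 - X * P) *ᵥ z) * (Metric.ball 0 R).indicator 1 (P *ᵥ z)

theorem measurable_dataWeight (P : Matrix (Fin p) (Fin n) ℝ) (r R : ℝ) :
    Measurable (dataWeight X P r R) := by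
  have hm : ∀ {k : ℕ} (C : Matrix (Fin k) (Fin n) ℝ), Measurable fun z : Fin n → ℝ => C *ᵥ z :=
    fun C => (continuous_const.matrix_mulVec continuous_id).measurable
  exact ((measurable_annulusIndicator r R).comp (hm _)).mul
    ((measurable_one.indicator Metric.isOpen_ball.measurableSet).comp (hm _))

theorem measurable_posteriorDensity_right (hSig : Measurable Sig) (hw : Measurable w)
    (z : Fin n → ℝ) : Measurable (posteriorDensity Sig X w z) :=
  Measurable.of_uncurry_left (f := posteriorDensity Sig X w) (measurable_posteriorDensity hSig hw)

/-- The average over the data of the posterior mass is finite. -/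
theorem lintegral_dataWeight_mul_posterior_lt_top (hSig : Measurable Sig) (hw : Measurable w)
    (hpos : ∀ ϑ, 0 < ϑ → (Matrix.of (Sig ϑ)).PosDef) (hwi : ∫⁻ ϑ in Ioi 0, w ϑ < ⊤)
    {P : Matrix (Fin p) (Fin n) ℝ} (hPX : P * X = 1) {r R : ℝ} (hr : 0 < r) (hrR : r < R) :
    ∫⁻ z, dataWeight X P r R z *
      ∫⁻ θ in univ ×ˢ Ioi 0 ×ˢ Ioi 0, posteriorDensity Sig X w z θ < ⊤ := by
  have hΦ := measurable_posteriorDensity (X := X) hSig hw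
  have hg := measurable_dataWeight (X := X) P r R
  set c := ENNReal.ofReal (R ^ 2 / r ^ 2) *
    ∫⁻ x : Fin n → ℝ, ENNReal.ofReal (stdNormalDensity x) with hc
  have hc' : c < ⊤ := ENNReal.mul_lt_top ENNReal.ofReal_lt_top
    (lt_of_le_of_lt (lintegral_mono fun x => Real.ofReal_le_enorm _)
      integrable_stdNormalDensity.2)
  set b := ∫⁻ β : Fin p → ℝ, (Metric.ball (0 : Fin p → ℝ) R).indicator (1 : (Fin p → ℝ) → ENNReal) β with hb
  have hb' : b < ⊤ := by
    rw [hb, lintegral_indicator_one Metric.isOpen_ball.measurableSet]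
    exact measure_ball_lt_top
  have hjoint : Measurable fun q : (Fin n → ℝ) × ((Fin p → ℝ) × ℝ × ℝ) =>
      dataWeight X P r R q.1 * posteriorDensity Sig X w q.1 q.2 := (hg.comp measurable_fst).mul hΦ
  set Ψ : (Fin p → ℝ) × ℝ × ℝ → ENNReal := fun θ =>
    ∫⁻ z, dataWeight X P r R z * posteriorDensity Sig X w z θ with hΨ
  have hΨm : Measurable Ψ := hjoint.lintegral_prod_left'
  have hβ : ∀ ϑ, 0 < ϑ → ∀ v, ∫⁻ β, Ψ (β, v, ϑ) = w ϑ * b * (ENNReal.ofReal (1 / v) *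
      ∫⁻ y, ENNReal.ofReal (normalDensity (Matrix.of (Sig ϑ)) v y) *
        annulusIndicator r R ((1 - X * P) *ᵥ y)) := by
    intro ϑ _ v
    have hn : Measurable fun y => ENNReal.ofReal (normalDensity (Matrix.of (Sig ϑ)) v y) :=
      ENNReal.measurable_ofReal.comp (continuous_normalDensity _ v).measurable
    have htr := lintegral_lintegral_translate hPX (measurable_annulusIndicator r R)
      ((measurable_one (β := Fin p → ℝ) (α := ENNReal)).indicator
        (Metric.isOpen_ball (x := 0) (ε := R)).measurableSet) hn
    have hX : ∀ β : Fin p → ℝ, Measurable fun z : Fin n → ℝ => z - X *ᵥ β := fun β =>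
      measurable_id.sub_const _
    have hX' : Measurable fun q : (Fin n → ℝ) × (Fin p → ℝ) => q.1 - X *ᵥ q.2 :=
      (continuous_fst.sub (continuous_const.matrix_mulVec continuous_snd)).measurable
    have hm : Measurable fun β : Fin p → ℝ =>
        ∫⁻ z, ENNReal.ofReal (normalDensity (Matrix.of (Sig ϑ)) v (z - X *ᵥ β)) *
          dataWeight X P r R z :=
      Measurable.lintegral_prod_left' (f := fun q : (Fin n → ℝ) × (Fin p → ℝ) =>
        ENNReal.ofReal (normalDensity (Matrix.of (Sig ϑ)) v (q.1 - X *ᵥ q.2)) *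
          dataWeight X P r R q.1) ((hn.comp hX').mul (hg.comp measurable_fst))
    have hinner : ∀ β, Ψ (β, v, ϑ) = (ENNReal.ofReal (1 / v) * w ϑ) *
        ∫⁻ z, ENNReal.ofReal (normalDensity (Matrix.of (Sig ϑ)) v (z - X *ᵥ β)) *
          dataWeight X P r R z := by
      intro β
      rw [← lintegral_const_mul _ (by exact (hn.comp (hX β)).mul hg)]
      refine lintegral_congr fun z => ?_
      simp only [posteriorDensity]
      ring
    simp only [hinner]
    rw [lintegral_const_mul _ hm]
    simp only [dataWeight]
    rw [htr]
    ring
  calc _ = ∫⁻ z, ∫⁻ θ in univ ×ˢ Ioi 0 ×ˢ Ioi 0,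
          dataWeight X P r R z * posteriorDensity Sig X w z θ := by
        refine lintegral_congr fun z => ?_
        rw [lintegral_const_mul _ (measurable_posteriorDensity_right hSig hw z)]
    _ = ∫⁻ θ in univ ×ˢ Ioi 0 ×ˢ Ioi 0, Ψ θ := lintegral_lintegral_swap hjoint.aemeasurable
    -- The order matters: `β` is removed by translation, then `v` by scaling, and only the prior
    -- mass of `ϑ` remains.
    _ = ∫⁻ ϑ in Ioi 0, ∫⁻ v in Ioi 0, ∫⁻ β, Ψ (β, v, ϑ) := by
        rw [volume_restrict_paramSpace, lintegral_prod_symm' _ hΨm,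
          lintegral_prod_symm' _ hΨm.lintegral_prod_left']
    _ ≤ ∫⁻ ϑ in Ioi 0, w ϑ * (b * c) := by
        refine setLIntegral_mono' measurableSet_Ioi fun ϑ hϑ => ?_
        have hmv : Measurable fun v : ℝ => ∫⁻ y, ENNReal.ofReal
            (normalDensity (Matrix.of (Sig ϑ)) v y) *
              annulusIndicator r R ((1 - X * P) *ᵥ y) := by
          refine Measurable.lintegral_prod_right' (f := fun q : ℝ × (Fin n → ℝ) => ENNReal.ofReal
            (normalDensity (Matrix.of (Sig ϑ)) q.1 q.2) *
              annulusIndicator r R ((1 - X * P) *ᵥ q.2)) ?_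
          exact (ENNReal.measurable_ofReal.comp (Measurable.normalDensity (A := fun _ => Sig ϑ)
            measurable_const measurable_fst measurable_snd)).mul
            ((measurable_annulusIndicator r R).comp
              (continuous_const.matrix_mulVec continuous_snd).measurable)
        have hmv' : Measurable fun v : ℝ => ENNReal.ofReal (1 / v) :=
          ENNReal.measurable_ofReal.comp (measurable_const.div measurable_id)
        simp only [hβ ϑ hϑ]
        rw [lintegral_const_mul _ (by exact hmv'.mul hmv), mul_assoc]
        gcongr
        exact lintegral_normalDensity_annulus_le (hpos ϑ hϑ) _ hr hrR
    _ < ⊤ := by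
        rw [lintegral_mul_const _ hw]
        exact ENNReal.mul_lt_top hwi (ENNReal.mul_lt_top hb' hc')

/-- For a proper prior of `ϑ`, the posterior is proper for almost all data. -/
theorem ae_lintegral_posteriorDensity_lt_top (hSig : Measurable Sig) (hw : Measurable w)
    (hpos : ∀ ϑ, 0 < ϑ → (Matrix.of (Sig ϑ)).PosDef) (hwi : ∫⁻ ϑ in Ioi 0, w ϑ < ⊤)
    (hX : X.rank = p) (hpn : p < n) :
    ∀ᵐ z, ∫⁻ θ in univ ×ˢ Ioi 0 ×ˢ Ioi 0, posteriorDensity Sig X w z θ < ⊤ := by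
  have hgram : IsUnit (Xᵀ * X).det := by
    have := isUnit_det_gram (Matrix.PosDef.one (n := Fin n) (R := ℝ)) (Y := X) (by simpa using hX)
    rwa [Matrix.mul_one] at this
  set P := (Xᵀ * X)⁻¹ * Xᵀ with hP
  have hPX : P * X = 1 := by
    rw [hP, Matrix.mul_assoc, Matrix.nonsing_inv_mul _ hgram]
  -- The rank of `X P` is at most `p < n`, so `1 - X P` is nonzero and its kernel is a proper
  -- subspace, hence null.
  have hker : ∀ᵐ z : Fin n → ℝ, (1 - X * P) *ᵥ z ≠ 0 := by
    have hne : LinearMap.ker (Matrix.toLin' (1 - X * P)) ≠ ⊤ := by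
      intro h
      rw [LinearMap.ker_eq_top, LinearEquiv.map_eq_zero_iff, sub_eq_zero] at h
      have h1 := Matrix.rank_mul_le_left X P
      rw [← h, Matrix.rank_one, hX, Fintype.card_fin] at h1
      omega
    have h0 := Measure.addHaar_submodule volume _ hne
    filter_upwards [measure_eq_zero_iff_ae_notMem.1 h0] with z hz h
    exact hz (LinearMap.mem_ker.2 ((Matrix.toLin'_apply _ _).trans h))
  -- The offset `2` keeps the inner radius strictly below the outer one even at `k = 0`.
  have hk : ∀ k : ℕ, ∀ᵐ z, dataWeight X P (1 / (k + 2)) (k + 2) z *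
      ∫⁻ θ in univ ×ˢ Ioi 0 ×ˢ Ioi 0, posteriorDensity Sig X w z θ < ⊤ := by
    intro k
    have hk2 : (1 : ℝ) < k + 2 := by
      have : (0 : ℝ) ≤ k := k.cast_nonneg
      linarith
    refine ae_lt_top ?_ (lintegral_dataWeight_mul_posterior_lt_top hSig hw hpos hwi hPX
      (by positivity) (((div_lt_one (by linarith)).2 hk2).trans hk2)).ne
    exact (measurable_dataWeight P _ _).mul
      (measurable_posteriorDensity hSig hw).lintegral_prod_right'
  filter_upwards [hker, ae_all_iff.2 hk] with z hz hzk
  have hNz := norm_pos_iff.2 hz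
  obtain ⟨k, hkz⟩ := exists_nat_gt
    (max (1 / ‖(1 - X * P) *ᵥ z‖) (max ‖(1 - X * P) *ᵥ z‖ ‖P *ᵥ z‖))
  rw [max_lt_iff, max_lt_iff] at hkz
  obtain ⟨hk1, hk2, hk3⟩ := hkz
  have hone : dataWeight X P (1 / (k + 2)) (k + 2) z = 1 := by
    rw [dataWeight, annulusIndicator, indicator_of_mem, indicator_of_mem]
    · simp
    · rw [mem_ball_zero_iff]
      linarith
    · refine ⟨?_, by linarith⟩
      rw [one_div_lt (by positivity) hNz]
      linarith
  have := hzk k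
  rwa [hone, one_mul] at this

end Posterior

end

/-! ### Assembly of both parts. -/

theorem theorem2 (S : SpectralDesign)
    (f : ℝ → Plane → ℝ) (h₁ : Plane → ℝ) (h₂ u : ℝ → ℝ) (a : ℝ)
    (hA1 : AssumptionA1 f h₁ h₂ u a)
    {p : ℕ} (hp : 0 < p) (F : Fin p → Plane → ℝ)
    (hintercept : ∀ x, F ⟨0, hp⟩ x = 1)
    (hpM : p < S.M) (hX₁ : (S.X₁ F).rank = p)
    (hLam : ∀ ϑ, 0 < ϑ → ∀ c : S.CoefIdx, 0 < S.aliasDensity f ϑ (S.freq (S.coefFreqIdx c))) :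
    -- part (a)
    (ContinuousOn (S.approxRefPrior f F) (Ioi 0) ∧
      S.approxRefPrior f F =O[𝓝[>] 0]
        (fun ϑ => min |deriv u ϑ| (|deriv u ϑ| / u ϑ ^ 2)) ∧
      S.approxRefPrior f F =O[atTop]
        (fun ϑ => min |deriv u ϑ| (|deriv u ϑ| / u ϑ ^ 2)) ∧
      (IntegrableOn (fun ϑ => min |deriv u ϑ| (|deriv u ϑ| / u ϑ ^ 2)) (Ioi 0) →
        IntegrableOn (S.approxRefPrior f F) (Ioi 0))) ∧
    -- part (b)
    (IntegrableOn (fun ϑ => min |deriv u ϑ| (|deriv u ϑ| / u ϑ ^ 2)) (Ioi 0) →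
      ∀ (K : ℝ → ℝ → ℝ), IsCorrelationWithDensity K f →
      ∀ (n : ℕ) (s : Fin n → Plane), Function.Injective s → p < n →
        (designMatrix F s).rank = p → AssumptionA2 (corrMatrix K s) →
        ∀ᵐ z : Fin n → ℝ,
          IntegrableOn
            (fun θ : (Fin p → ℝ) × ℝ × ℝ =>
              gaussianLikelihood K s F z θ.1 θ.2.1 θ.2.2 *
                (S.approxRefPrior f F θ.2.2 / θ.2.1))
            (univ ×ˢ Ioi 0 ×ˢ Ioi 0)) := by
  obtain ⟨C, hC⟩ := SpectralDesign.exists_approxRefPrior_le hA1 hX₁ hLam hp hintercept hpM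
  have hcont := SpectralDesign.continuousOn_approxRefPrior hA1 hX₁ hLam
  have hnorm : ∀ ϑ, 0 < ϑ → ‖S.approxRefPrior f F ϑ‖
      ≤ C * ‖min |deriv u ϑ| (|deriv u ϑ| / u ϑ ^ 2)‖ := by
    intro ϑ hϑ
    rw [Real.norm_of_nonneg (S.approxRefPrior_nonneg f F _), Real.norm_of_nonneg (by positivity)]
    exact hC ϑ hϑ
  have hint : IntegrableOn (fun ϑ => min |deriv u ϑ| (|deriv u ϑ| / u ϑ ^ 2)) (Ioi 0) →
      IntegrableOn (S.approxRefPrior f F) (Ioi 0) := by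
    intro h
    refine (h.norm.const_mul C).mono' (hcont.aestronglyMeasurable measurableSet_Ioi) ?_
    filter_upwards [ae_restrict_mem measurableSet_Ioi] with ϑ hϑ using hnorm ϑ hϑ
  refine ⟨⟨hcont, ?_, ?_, hint⟩, ?_⟩
  · refine Asymptotics.IsBigO.of_bound C ?_
    filter_upwards [self_mem_nhdsWithin] with ϑ hϑ using hnorm ϑ hϑ
  · refine Asymptotics.IsBigO.of_bound C ?_
    filter_upwards [eventually_gt_atTop 0] with ϑ hϑ using hnorm ϑ hϑ
  intro hu K hK n s hs hpn hrank _
  obtain ⟨Sig, hSig, hSigEq⟩ := exists_measurable_eq_corrMatrix hA1 hK s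
  -- The prior is continuous only on positive `ϑ`; extension by zero makes it measurable on the
  -- line.
  set w : ℝ → ENNReal := (Ioi (0 : ℝ)).indicator
    fun ϑ => ENNReal.ofReal (S.approxRefPrior f F ϑ) with hwdef
  have hw : Measurable w := by
    rw [hwdef, ← piecewise_eq_indicator]
    exact (ENNReal.continuous_ofReal.comp_continuousOn hcont).measurable_piecewise
      continuousOn_const measurableSet_Ioi
  have hw' : ∀ ϑ, 0 < ϑ → w ϑ = ENNReal.ofReal (S.approxRefPrior f F ϑ) := fun ϑ hϑ =>
    indicator_of_mem (mem_Ioi.2 hϑ) _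
  have hwi : ∫⁻ ϑ in Ioi 0, w ϑ < ⊤ := by
    rw [setLIntegral_congr_fun measurableSet_Ioi fun ϑ hϑ => hw' ϑ hϑ]
    exact lt_of_le_of_lt (lintegral_mono fun ϑ => Real.ofReal_le_enorm _) (hint hu).2
  have hpos : ∀ ϑ, 0 < ϑ → (Matrix.of (Sig ϑ)).PosDef := fun ϑ hϑ => by
    rw [hSigEq ϑ hϑ]
    exact posDef_corrMatrix hA1 hK hs hϑ
  have hset : MeasurableSet ((univ : Set (Fin p → ℝ)) ×ˢ Ioi (0 : ℝ) ×ˢ Ioi (0 : ℝ)) :=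
    MeasurableSet.univ.prod (measurableSet_Ioi.prod measurableSet_Ioi)
  filter_upwards [ae_lintegral_posteriorDensity_lt_top hSig hw hpos hwi hrank hpn] with z hz
  have hmeas : Measurable (posteriorDensity Sig (designMatrix F s) w z) :=
    measurable_posteriorDensity_right hSig hw z
  have hI : IntegrableOn (fun θ => (posteriorDensity Sig (designMatrix F s) w z θ).toReal)
      (univ ×ˢ Ioi 0 ×ˢ Ioi 0) := integrable_toReal_of_lintegral_ne_top hmeas.aemeasurable hz.ne
  refine hI.congr_fun (fun θ hθ => ?_) hset
  obtain ⟨-, hv, hϑ⟩ := hθ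
  have hv' : 0 < θ.2.1 := hv
  have hn := normalDensity_nonneg (hpos _ hϑ) hv' (z - designMatrix F s *ᵥ θ.1)
  simp only [posteriorDensity]
  rw [hw' _ hϑ, ENNReal.toReal_mul, ENNReal.toReal_mul, ENNReal.toReal_ofReal hn,
    ENNReal.toReal_ofReal (by positivity), ENNReal.toReal_ofReal (S.approxRefPrior_nonneg f F _),
    gaussianLikelihood_eq, hSigEq _ hϑ]
  ring
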